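/- **Setting.** Let $\mathcal D$ be a probability distribution of $\xi$ and $f(w;\xi)$, $w\in\mathbb R^p$, a loss such that for every $\xi$ the function $f(\cdot;\xi)$ is convex and $L$-smooth ($\|\nabla f(w;\xi)-\nabla f(w';\xi)\|\le L\|w-w'\|$), and $F(w)=\mathbb E_{\xi\sim\mathcal D}[f(w;\xi)]$ is $\mu$-strongly convex with minimizer $w_*$, where $L,\mu>0$. Assume that $N=2\,\mathbb E\|\nabla f(w_*;\xi)\|^2$ is finite and positive. Given step sizes $\eta_t$ and a delay function $\tau$, consider the asynchronous recursion $$w_{t+1}=w_t-\eta_t\nabla f(\hat w_t;\xi_t),$$ where $\xi_t\sim\mathcal D$ is independent of the history before iteration $t$ (the earlier samples and all reads up to and including the one for iteration $t$), and each entry $k$ of the read vector is $(\hat w_t)_k=(w_0)_k-\sum_{j\in\mathcal U_{t,k}}\eta_j(\nabla f(\hat w_j;\xi_j))_k$ for some, possibly random, set $\mathcal U_{t,k}\subseteq\{0,\dots,t-1\}$ that contains all $j\ge 0$ with $j\le t-\tau(t)-1$ (consistency with delay function $\tau$). **Parameters.** Let $d,m\ge 0$ be integers with $m+1\ge 2e(d+1)$,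 and set $$s_i=\Big\lceil \frac{m+i+1}{16(d+1)^2}\,\frac1{\ln\frac{m+i+1}{2(d+1)}}\Big\rceil,\qquad M_0=\frac{(m+1)^2}{4},\qquad M_1=\max\Big\{d+1,\ \frac{2L\cdot 36}{\mu},\ \frac{s_0}{2}\Big\},$$ $$\tau(x)=M_1+\sqrt{\frac{x+M_0}{4\ln(x+M_0)}},\qquad \bar\eta_i=\frac{12}{\mu}\cdot\frac{1}{\sigma_i+2M_1+\sqrt{\frac{M_0+\sigma_i}{\ln(M_0+\sigma_i)}}},\quad \sigma_i=\sum_{j=0}^{i-1}s_j .$$ Iteration $t$ uses the step size $\eta_t=\bar\eta_i$ of its round $i$, i.e. $\sigma_i\le t<\sigma_{i+1}$. **Theorem.** 1. $(s_i)$ is nondecreasing, $s_i=\Theta(i/\ln i)$, and $\tau\big(\sum_{j=0}^i s_j\big)\ge\sum_{j=i-d}^i s_j$ for all $i\ge d+1$. 2. $(\bar\eta_i)$ is nonincreasing and $\bar\eta_i=O(\ln i/i^2)$. 3. For every $R>0$ there is $T_0$, depending only on $d,m,L,\mu,N,R$, such that for all such problems with $\|w_0-w_*\|\le R$ and all runs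 of the recursion consistent with $\tau$, for all $t\ge T_0$, the expectations $\mathbb E\|w_t-w_*\|^2$ and $\mathbb E\|\hat w_t-w_*\|^2$ are finite and both at most $$r(t)=\frac{8\cdot 36^2N}{\mu^2}\cdot\frac{t}{\Big(t+2M_1+\sqrt{\frac{M_0+t}{\ln(M_0+t)}}-1\Big)^2}.$$ 4. $r(t)\sim\frac{8\cdot36^2N}{\mu^2}\frac1t$ as $t\to\infty$, and for every constant $c$, $r(t)\le\frac{8\cdot 36^2N}{\mu^2}\frac1t\big(1-\frac ct\big)$ for all large $t$. 5. This is optimal up to a factor $16\cdot 36^2$: if $\mu\le L$ and $R>0$, there is a constant $C$ such that for $\ell(t)=\frac12\frac N{\mu^2}\frac1t\big(1-C\frac{\ln t}t\big)$ one has $r(t)\le 16\cdot 36^2\,\ell(t)$ for all large $t$, and in every dimension $p\ge1$ there is a problem as above (with the same $L,\mu,N$) and a $w_0$ with $\|w_0-w_*\|=R$ such that $\mathbb E\|w_t-w_*\|^2\ge\ell(t)$ for all $t\ge2$, for every deterministic step size sequence and all deterministic read sets $\mathcal U_{t,k}\subseteq\{0,\dots,t-1\}$ (in particular for serial SGD,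 $\hat w_t=w_t$). -/

import Mathlib

open Filter Topology Asymptotics MeasureTheory ProbabilityTheory

universe u v

namespace AsyncFL

noncomputable section

/-- Sample size of round `i`:
`⌈ (m+i+1) / (16 (d+1)²) · 1 / ln ((m+i+1) / (2 (d+1))) ⌉`. -/
def sampleSize (d m i : ℕ) : ℕ :=
  ⌈((m : ℝ) + i + 1) / (16 * ((d : ℝ) + 1) ^ 2)
    * (1 / Real.log (((m : ℝ) + i + 1) / (2 * ((d : ℝ) + 1))))⌉₊

/-- Number of gradient computations in the rounds `0, …, i-1`. -/
def samplesBefore (s : ℕ → ℕ) (i : ℕ) : ℕ := ∑ j ∈ Finset.range i, s j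

/-- The round to which iteration `t` belongs, that is, the least `i` with
`t < s 0 + ⋯ + s i`. -/
def roundOf (s : ℕ → ℕ) (t : ℕ) : ℕ := sInf {i | t < samplesBefore s (i + 1)}

/-- `M₁ = max {d+1, 2 L α / μ, s₀ / 2}` with `α = 36`. -/
def M1 (d m : ℕ) (L μ : ℝ) : ℝ :=
  max ((d : ℝ) + 1) (max (2 * L * 36 / μ) ((1 / 2) * (sampleSize d m 0 : ℝ)))

/-- `M₀ = (m+1)² / 4`. -/
def M0 (m : ℕ) : ℝ := ((m : ℝ) + 1) ^ 2 / 4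

/-- The delay function `τ(x) = M₁ + √((x + M₀) / (4 ln (x + M₀)))`. -/
def delay (d m : ℕ) (L μ : ℝ) (x : ℝ) : ℝ :=
  M1 d m L μ + Real.sqrt ((x + M0 m) / (4 * Real.log (x + M0 m)))

/-- The delay condition on a sample size sequence:
`τ(s 0 + ⋯ + s i) ≥ s (i-d) + ⋯ + s i` for all `i ≥ d + 1`. -/
def DelayCondition (τ : ℝ → ℝ) (s : ℕ → ℕ) (d : ℕ) : Prop :=
  ∀ i, d + 1 ≤ i →
    ((∑ j ∈ Finset.Icc (i - d) i, s j : ℕ) : ℝ) ≤ τ ((∑ j ∈ Finset.Icc 0 i, s j : ℕ) : ℝ)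

/-- The round step size of round `i`. -/
def roundStep (d m : ℕ) (L μ : ℝ) (i : ℕ) : ℝ :=
  12 / μ * (1 / ((samplesBefore (sampleSize d m) i : ℝ) + 2 * M1 d m L μ
    + Real.sqrt ((M0 m + (samplesBefore (sampleSize d m) i : ℝ))
        / Real.log (M0 m + (samplesBefore (sampleSize d m) i : ℝ)))))

/-- The step size of iteration `t`: the round step size of the round containing `t`. -/
def stepSize (d m : ℕ) (L μ : ℝ) (t : ℕ) : ℝ :=
  roundStep d m L μ (roundOf (sampleSize d m) t)

/-- The guaranteed rate
`(8·36²·N/μ²) · t / (t + 2 M₁ + √((M₀ + t) / ln (M₀ + t)) - 1)²`. -/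
def rate (d m : ℕ) (L μ N : ℝ) (t : ℕ) : ℝ :=
  8 * 36 ^ 2 * N / μ ^ 2 *
    ((t : ℝ) / ((t : ℝ) + 2 * M1 d m L μ
      + Real.sqrt ((M0 m + t) / Real.log (M0 m + t)) - 1) ^ 2)

/-- The objective `F(w) = 𝔼_{ξ ∼ D} f(w; ξ)`. -/
def objective {p : ℕ} {Ξ : Type*} [MeasurableSpace Ξ] (D : Measure Ξ)
    (f : EuclideanSpace ℝ (Fin p) → Ξ → ℝ) (w : EuclideanSpace ℝ (Fin p)) : ℝ :=
  ∫ x, f w x ∂D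

/-- `f` and `D` form a stochastic optimization problem on `ℝ^p`: each `f(·; ξ)` is convex and
`L`-smooth, `F` is `μ`-strongly convex, `wstar` minimizes `F`, and
`N = 2 𝔼 ‖∇f(wstar; ξ)‖²` is finite. -/
structure IsProblem {p : ℕ} {Ξ : Type*} [MeasurableSpace Ξ] (D : Measure Ξ)
    (f : EuclideanSpace ℝ (Fin p) → Ξ → ℝ) (L μ N : ℝ)
    (wstar : EuclideanSpace ℝ (Fin p)) : Prop where
  prob : IsProbabilityMeasure D
  measurable : ∀ w, Measurable (f w)
  integrable : ∀ w, Integrable (f w) D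
  differentiable : ∀ x, Differentiable ℝ (fun w => f w x)
  smooth : ∀ x w w',
    ‖gradient (fun v => f v x) w - gradient (fun v => f v x) w'‖ ≤ L * ‖w - w'‖
  convex : ∀ x w w',
    f w x - f w' x ≥ inner ℝ (gradient (fun v => f v x) w') (w - w')
  stronglyConvex : ∀ w w', objective D f w - objective D f w' ≥
    inner ℝ (gradient (objective D f) w') (w - w') + μ / 2 * ‖w - w'‖ ^ 2
  minimizer : ∀ w, objective D f wstar ≤ objective D f w
  noise_finite : Integrable (fun x => ‖gradient (fun v => f v x) wstar‖ ^ 2) D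
  noise_eq : N = 2 * ∫ x, ‖gradient (fun v => f v x) wstar‖ ^ 2 ∂D

/-- A run of the asynchronous recursion `w (t+1) = w t - η t ∇f(ŵ t; ξ t)` that is consistent
with the delay function `τ`.

`what t` is the vector read before iteration `t`. Its entries are read one by one: entry `k`
contains exactly the updates made in the iterations `j ∈ U t k`, which are among the previous
ones and include all `j ≤ t - τ(t) - 1`. The filtration `ℱ` is the history: `ℱ t` knows the
samples `ξ 0, …, ξ (t-1)` and the read sets `U 0, …, U t`, and the sample `ξ t` is drawn
from `D` independently of it. -/
structure IsRun {p : ℕ} {Ξ Ω : Type*} [MeasurableSpace Ξ] {mΩ : MeasurableSpace Ω}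
    (P : Measure Ω) (D : Measure Ξ) (f : EuclideanSpace ℝ (Fin p) → Ξ → ℝ)
    (w0 : EuclideanSpace ℝ (Fin p)) (η : ℕ → ℝ) (τ : ℝ → ℝ)
    (ℱ : Filtration ℕ mΩ) (ξ : ℕ → Ω → Ξ) (U : ℕ → Fin p → Ω → Finset ℕ)
    (w what : ℕ → Ω → EuclideanSpace ℝ (Fin p)) : Prop where
  prob : IsProbabilityMeasure P
  sample_measurable : ∀ t, Measurable[ℱ (t + 1)] (ξ t)
  sample_law : ∀ t, P.map (ξ t) = D
  sample_indep : ∀ t, Indep (MeasurableSpace.comap (ξ t) inferInstance) (ℱ t) P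
  read_measurable : ∀ t k j, MeasurableSet[ℱ t] {ω | j ∈ U t k ω}
  read_previous : ∀ t k ω, ∀ j ∈ U t k ω, j < t
  read_delay : ∀ (t : ℕ) k ω (j : ℕ), (j : ℝ) ≤ (t : ℝ) - τ t - 1 → j ∈ U t k ω
  init : ∀ ω, w 0 ω = w0
  read_eq : ∀ t ω k, what t ω k =
    w0 k - ∑ j ∈ U t k ω, η j * gradient (fun v => f v (ξ j ω)) (what j ω) k
  step : ∀ t ω, w (t + 1) ω =
    w t ω - η t • gradient (fun v => f v (ξ t ω)) (what t ω)

/-- The lower bound `½ · N/μ² · (1/t) · (1 - C (ln t)/t)`. -/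
def lowerRate (μ N C : ℝ) (t : ℕ) : ℝ :=
  1 / 2 * (N / μ ^ 2) * (1 / (t : ℝ)) * (1 - C * (Real.log t / t))

end

end AsyncFL

/-!
The sample sizes and step sizes are handled by the monotonicity of `x / log x` on `[e, ∞)`. In
terms of `y i = (m + i + 1) / (2 (d + 1)) ≥ e`, the sample size of round `i` is the round-up of
`y i / log (y i) / (8 (d + 1))`, and comparing the sum of the sample sizes with an arithmetic
progression shows that `M₀` plus the number of samples up to round `i` is at least
`(y i)² / (8 log (y i))` (`sq_scaledIndex_le`); this gives the delay condition
(`delayCondition`). The delay condition bounds the length of a round by the delay function, which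
is sublinear; hence the step size of iteration `t` eventually lies between `10 / (μ t)` and
`14 / (μ t)` (`eventually_le_stepSize`, `eventually_stepSize_le`).

For the convergence rate, let `a t = 𝔼 ‖w t - w⋆‖²` and `b t = 𝔼 ‖ŵ t - w t‖²`, and let `G t` be
the second moment of the gradient used in iteration `t`. Expanding the square in one step of the
recursion, and replacing the sampled gradient by its mean (`IsRun.le_integral_inner`), which is
strongly monotone, gives `a (t+1) ≤ (1 - μ η t / 4) a t + K η t b t + (η t)² G t`, and smoothness
gives `G t ≤ 4 L² (a t + b t) + N`. Each coordinate of the read vector misses at most the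
`n = ⌈τ t⌉` most recent updates, so the Cauchy–Schwarz inequality yields
`b t ≤ n ∑ (η j)² G j` over these updates (`IsRun.delayedRecursion`). The rest concerns real
sequences only (`DelayedRecursion.eventually_le`). Since `n² = o(t)` and `η t` is of order `1 / t`,
the read error `b t` is `o(1 / t)` times any bound on the previous `G j`, so the contraction first
keeps the sequences bounded (`DelayedRecursion.exists_bound`). Then the read errors are `o(1 / t)`,
only the gradient noise `N` at the minimizer remains, and the recursion
`a (t+1) ≤ (1 - 2 / t) a t + Q / t²` with `Q = 200 N / μ²` gives `2 a t + 2 b t ≤ 5 Q / t`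
eventually, which is well below the rate. All bounds depend on the parameters only.

For the lower bound, consider the loss `μ / 2 ‖w‖² ± ⟪v, w⟫` with a fair sign and with `v` and
`w 0` on one coordinate axis. The recursion is equivariant under translations, so with
deterministic step sizes and read sets every iterate is an affine combination of `w 0` and of the
`t` independent minimizers of the sampled losses (`IsRun.exists_affine_combination`); among these,
the least second moment is `1 / (1 / R² + t / s)` with `s = N / (2 μ²)`.
-/

namespace AsyncFL

noncomputable section

/-! ### The function `x / log x` -/

lemma monotoneOn_div_log : MonotoneOn (fun x : ℝ => x / Real.log x) (Set.Ici (Real.exp 1)) := by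
  intro x hx y hy hxy
  simp only [Set.mem_Ici] at hx hy
  have hx0 : 0 < x := (Real.exp_pos 1).trans_le hx
  have hlx : 1 ≤ Real.log x := (Real.le_log_iff_exp_le hx0).2 hx
  have hly : 1 ≤ Real.log y := (Real.le_log_iff_exp_le (hx0.trans_le hxy)).2 hy
  have h := Real.log_div_self_antitoneOn hx hy hxy
  have h' : 0 < Real.log y / y := div_pos (by linarith) (hx0.trans_le hxy)
  have := inv_anti₀ h' h
  simpa [inv_div] using this

lemma exp_one_le_div_log {x : ℝ} (hx : Real.exp 1 ≤ x) : Real.exp 1 ≤ x / Real.log x := by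
  simpa using monotoneOn_div_log (Set.mem_Ici.2 le_rfl) (Set.mem_Ici.2 hx) hx

lemma tendsto_div_log_atTop : Tendsto (fun x : ℝ => x / Real.log x) atTop atTop := by
  have h : Tendsto (fun x : ℝ => Real.log x / x) atTop (𝓝[>] 0) := by
    refine tendsto_nhdsWithin_iff.2 ⟨Real.isLittleO_log_id_atTop.tendsto_div_nhds_zero, ?_⟩
    filter_upwards [eventually_gt_atTop 1] with x hx
    exact div_pos (Real.log_pos hx) (by linarith)
  simpa [Function.comp_def] using tendsto_inv_nhdsGT_zero.comp h

/-! ### Sample sizes and the delay condition -/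

/-- The quantity `y i = (m + i + 1) / (2 (d + 1))`, in terms of which the sample size of round `i`
is the round-up of `y i / log (y i) / (8 (d + 1))`. -/
def scaledIndex (d m i : ℕ) : ℝ := ((m : ℝ) + i + 1) / (2 * ((d : ℝ) + 1))

lemma sampleSize_eq (d m i : ℕ) : sampleSize d m i =
    ⌈scaledIndex d m i / Real.log (scaledIndex d m i) / (8 * ((d : ℝ) + 1))⌉₊ := by
  unfold sampleSize
  congr 1
  change _ * (1 / Real.log (scaledIndex d m i)) = _
  have : ((m : ℝ) + i + 1) / (16 * ((d : ℝ) + 1) ^ 2)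
      = scaledIndex d m i / (8 * ((d : ℝ) + 1)) := by
    have : (d : ℝ) + 1 ≠ 0 := by positivity
    unfold scaledIndex
    field_simp
    ring
  rw [this]
  ring

lemma sum_Icc_eq_samplesBefore (s : ℕ → ℕ) (i : ℕ) :
    ∑ j ∈ Finset.Icc 0 i, s j = samplesBefore s (i + 1) := by
  unfold samplesBefore
  congr 1
  ext j
  simp

lemma scaledIndex_mono (d m : ℕ) : Monotone (scaledIndex d m) := by
  intro i j hij
  unfold scaledIndex
  gcongr

section Params

variable {d m : ℕ} (hm : 2 * Real.exp 1 * ((d : ℝ) + 1) ≤ (m : ℝ) + 1)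

include hm

lemma exp_one_le_scaledIndex (i : ℕ) : Real.exp 1 ≤ scaledIndex d m i := by
  unfold scaledIndex
  rw [le_div_iff₀ (by positivity)]
  have : (0 : ℝ) ≤ i := by positivity
  nlinarith

lemma one_le_log_scaledIndex (i : ℕ) : 1 ≤ Real.log (scaledIndex d m i) := by
  have h := exp_one_le_scaledIndex hm i
  exact (Real.le_log_iff_exp_le ((Real.exp_pos 1).trans_le h)).2 h

lemma scaledIndex_pos (i : ℕ) : 0 < scaledIndex d m i :=
  (Real.exp_pos 1).trans_le (exp_one_le_scaledIndex hm i)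

lemma sampleSize_mono : Monotone (sampleSize d m) := by
  intro i j hij
  rw [sampleSize_eq, sampleSize_eq]
  refine Nat.ceil_mono (div_le_div_of_nonneg_right ?_ (by positivity))
  exact monotoneOn_div_log (exp_one_le_scaledIndex hm i) (exp_one_le_scaledIndex hm j)
    (scaledIndex_mono d m hij)

lemma sampleSize_pos (i : ℕ) : 0 < sampleSize d m i := by
  rw [sampleSize_eq]
  have := exp_one_le_div_log (exp_one_le_scaledIndex hm i)
  have := Real.exp_pos 1
  exact Nat.ceil_pos.2 (div_pos (by linarith) (by positivity))

/-- Every sample size before round `i + 1` is bounded below by replacing the logarithm in its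
definition by that of round `i`; the numerators then form an arithmetic progression. -/
lemma samplesBefore_lower {k i : ℕ} (hk : k ≤ i + 1) :
    ((k : ℝ) * ((m : ℝ) + 1) + k * ((k : ℝ) - 1) / 2)
      / (16 * ((d : ℝ) + 1) ^ 2 * Real.log (scaledIndex d m i))
      ≤ samplesBefore (sampleSize d m) k := by
  induction k with
  | zero => simp [samplesBefore]
  | succ k ih =>
    have h1 := ih (by omega)
    have h2 : ((m : ℝ) + k + 1) / (16 * ((d : ℝ) + 1) ^ 2 * Real.log (scaledIndex d m i))
        ≤ sampleSize d m k := by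
      rw [sampleSize_eq]
      refine le_trans ?_ (Nat.le_ceil _)
      have hk' := one_le_log_scaledIndex hm k
      have hlog : Real.log (scaledIndex d m k) ≤ Real.log (scaledIndex d m i) :=
        Real.log_le_log (scaledIndex_pos hm k) (scaledIndex_mono d m (by omega))
      have : scaledIndex d m k / Real.log (scaledIndex d m k) / (8 * ((d : ℝ) + 1))
          = ((m : ℝ) + k + 1) / (16 * ((d : ℝ) + 1) ^ 2 * Real.log (scaledIndex d m k)) := by
        have : (d : ℝ) + 1 ≠ 0 := by positivity
        rw [div_div, scaledIndex, div_div]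
        congr 1
        ring
      rw [this]
      gcongr
    have h3 : samplesBefore (sampleSize d m) (k + 1)
        = samplesBefore (sampleSize d m) k + sampleSize d m k := by
      simp [samplesBefore, Finset.sum_range_succ]
    rw [h3]
    push_cast
    refine le_trans (le_of_eq ?_) (add_le_add h1 h2)
    rw [← add_div]
    congr 1
    ring

lemma exp_one_le_M0 : Real.exp 1 ≤ M0 m := by
  unfold M0
  have h1 : 1 ≤ Real.exp 1 := Real.one_le_exp (by norm_num)
  have h2 : (0 : ℝ) ≤ d := by positivity
  nlinarith [mul_nonneg h2 (Real.exp_pos 1).le]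

/-- The budget `M₀` makes up for the initial part of the arithmetic progression in
`samplesBefore_lower`. -/
lemma sq_scaledIndex_le (i : ℕ) :
    scaledIndex d m i ^ 2 / (8 * Real.log (scaledIndex d m i))
      ≤ samplesBefore (sampleSize d m) (i + 1) + M0 m := by
  have h1 := samplesBefore_lower hm (k := i + 1) le_rfl
  have hl := one_le_log_scaledIndex hm i
  set l := Real.log (scaledIndex d m i)
  have hd : (1 : ℝ) ≤ (d : ℝ) + 1 := by
    have : (0 : ℝ) ≤ d := by positivity
    linarith
  set q := (d : ℝ) + 1
  have hM : ((m : ℝ) + 1) ^ 2 / (32 * q ^ 2 * l) ≤ M0 m := by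
    unfold M0
    refine div_le_div_of_nonneg_left (by positivity) (by norm_num) ?_
    nlinarith [mul_le_mul (one_le_pow₀ hd (n := 2)) hl (by norm_num) (by positivity)]
  refine le_trans ?_ (add_le_add h1 hM)
  have e1 : scaledIndex d m i ^ 2 / (8 * l) = ((m : ℝ) + i + 1) ^ 2 / (32 * q ^ 2 * l) := by
    unfold scaledIndex
    rw [div_pow, div_div]
    congr 1
    change (2 * q) ^ 2 * (8 * l) = _
    ring
  have e2 (a b : ℝ) : a / (16 * q ^ 2 * l) + b / (32 * q ^ 2 * l)
      = (2 * a + b) / (32 * q ^ 2 * l) := by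
    have : q ≠ 0 := by positivity
    field_simp
    ring
  rw [e1, e2]
  gcongr
  push_cast
  have : (0 : ℝ) ≤ i := by positivity
  have : (0 : ℝ) ≤ m := by positivity
  nlinarith

lemma scaledIndex_div_log_le_sqrt (i : ℕ) :
    scaledIndex d m i / Real.log (scaledIndex d m i) / 8 ≤
      Real.sqrt ((samplesBefore (sampleSize d m) (i + 1) + M0 m)
        / (4 * Real.log (samplesBefore (sampleSize d m) (i + 1) + M0 m))) := by
  set S : ℝ := samplesBefore (sampleSize d m) (i + 1) + M0 m with hS
  have hSe : Real.exp 1 ≤ S := by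
    have : (0 : ℝ) ≤ samplesBefore (sampleSize d m) (i + 1) := by positivity
    linarith [exp_one_le_M0 hm]
  have hZS := sq_scaledIndex_le hm i
  rw [← hS] at hZS
  have hl := one_le_log_scaledIndex hm i
  have hy := exp_one_le_scaledIndex hm i
  have hy0 := scaledIndex_pos hm i
  set y := scaledIndex d m i
  set l := Real.log y with hl_def
  set Z := y ^ 2 / (8 * l) with hZ
  have hZ0 : 0 < Z := by positivity
  have e1 : (y / l / 8) ^ 2 = Z / (8 * l) := by
    rw [hZ]; field_simp
  apply Real.le_sqrt_of_sq_le
  rw [e1]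
  have key : Z / (2 * l) ≤ S / Real.log S := by
    by_cases h : Real.exp 1 ≤ Z
    · refine le_trans ?_ (monotoneOn_div_log h hSe hZS)
      have hlZ : 1 ≤ Real.log Z := (Real.le_log_iff_exp_le hZ0).2 h
      have : Real.log Z ≤ 2 * l := by
        have : Z ≤ y ^ 2 := div_le_self (by positivity) (by linarith)
        calc Real.log Z ≤ Real.log (y ^ 2) := Real.log_le_log hZ0 this
          _ = 2 * l := by rw [Real.log_pow]; norm_num [hl_def]
      exact div_le_div_of_nonneg_left hZ0.le (by linarith) this
    · refine le_trans ?_ (exp_one_le_div_log hSe)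
      push Not at h
      refine le_trans (div_le_self hZ0.le (by linarith)) h.le
  have e2 : Z / (8 * l) = Z / (2 * l) / 4 := by field_simp; norm_num
  have e3 : S / (4 * Real.log S) = S / Real.log S / 4 := by
    rw [div_div, mul_comm]
  rw [e2, e3]
  linarith

lemma delayCondition (L μ : ℝ) : DelayCondition (delay d m L μ) (sampleSize d m) d := by
  intro i hi
  rw [sum_Icc_eq_samplesBefore, delay]
  have h1 := scaledIndex_div_log_le_sqrt hm i
  have hM : (d : ℝ) + 1 ≤ M1 d m L μ := le_max_left _ _
  refine le_trans ?_ (add_le_add hM h1)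
  have hs : (sampleSize d m i : ℝ)
      ≤ scaledIndex d m i / Real.log (scaledIndex d m i) / (8 * ((d : ℝ) + 1)) + 1 := by
    rw [sampleSize_eq]
    refine (Nat.ceil_lt_add_one ?_).le
    have := scaledIndex_pos hm i
    have := one_le_log_scaledIndex hm i
    positivity
  have hsum : (∑ j ∈ Finset.Icc (i - d) i, sampleSize d m j) ≤ (d + 1) * sampleSize d m i := by
    refine (Finset.sum_le_card_nsmul _ _ (sampleSize d m i) ?_).trans ?_
    · intro j hj
      exact sampleSize_mono hm (Finset.mem_Icc.1 hj).2
    · simp only [Nat.card_Icc, smul_eq_mul]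
      gcongr
      omega
  calc ((∑ j ∈ Finset.Icc (i - d) i, sampleSize d m j : ℕ) : ℝ)
      ≤ ((d : ℝ) + 1) * sampleSize d m i := by exact_mod_cast hsum
    _ ≤ ((d : ℝ) + 1) * (scaledIndex d m i / Real.log (scaledIndex d m i)
          / (8 * ((d : ℝ) + 1)) + 1) := by gcongr
    _ = _ := by
      have : (d : ℝ) + 1 ≠ 0 := by positivity
      field_simp
      ring

end Params

/-! ### Growth of the sample sizes and decay of the round step sizes -/

lemma tendsto_scaledIndex_div (d m : ℕ) :
    Tendsto (fun i : ℕ => scaledIndex d m i / i) atTop (𝓝 (1 / (2 * ((d : ℝ) + 1)))) := by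
  have h : Tendsto (fun i : ℕ => ((m : ℝ) + 1) / (i : ℝ)) atTop (𝓝 0) :=
    tendsto_const_div_atTop_nhds_zero_nat _
  have h2 : Tendsto (fun i : ℕ => (1 + ((m : ℝ) + 1) / (i : ℝ)) * (1 / (2 * ((d : ℝ) + 1))))
      atTop (𝓝 ((1 + 0) * (1 / (2 * ((d : ℝ) + 1))))) := (h.const_add 1).mul_const _
  rw [add_zero, one_mul] at h2
  refine h2.congr' ?_
  filter_upwards [eventually_gt_atTop 0] with i hi
  have : (i : ℝ) ≠ 0 := by positivity
  unfold scaledIndex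
  field_simp
  ring

lemma tendsto_log_scaledIndex_div (d m : ℕ) :
    Tendsto (fun i : ℕ => Real.log (scaledIndex d m i) / Real.log i) atTop (𝓝 1) := by
  have hlog : Tendsto (fun i : ℕ => Real.log (i : ℝ)) atTop atTop :=
    Real.tendsto_log_atTop.comp tendsto_natCast_atTop_atTop
  have h1 : Tendsto (fun i : ℕ => Real.log (scaledIndex d m i / i)) atTop
      (𝓝 (Real.log (1 / (2 * ((d : ℝ) + 1))))) :=
    (tendsto_scaledIndex_div d m).log (by positivity)
  have h2 := (h1.div_atTop hlog).add_const 1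
  rw [zero_add] at h2
  refine h2.congr' ?_
  filter_upwards [eventually_gt_atTop 1] with i hi
  have hi0 : (i : ℝ) ≠ 0 := by positivity
  have : 0 < Real.log i := Real.log_pos (by exact_mod_cast hi)
  have hy : scaledIndex d m i ≠ 0 := by unfold scaledIndex; positivity
  rw [Real.log_div hy hi0]
  field_simp
  ring

lemma tendsto_scaledIndex (d m : ℕ) : Tendsto (scaledIndex d m) atTop atTop := by
  have h := (tendsto_scaledIndex_div d m).pos_mul_atTop (by positivity)
    (tendsto_natCast_atTop_atTop (R := ℝ))
  refine h.congr' ?_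
  filter_upwards [eventually_gt_atTop 0] with i hi
  have : (i : ℝ) ≠ 0 := by positivity
  field_simp

lemma sampleSize_isTheta (d m : ℕ) : (fun i : ℕ => (sampleSize d m i : ℝ)) =Θ[atTop]
    fun i : ℕ => (i : ℝ) / Real.log i := by
  have hc : (0 : ℝ) < 8 * ((d : ℝ) + 1) := by positivity
  have h0 : Tendsto (fun i => scaledIndex d m i / Real.log (scaledIndex d m i)
      / (8 * ((d : ℝ) + 1))) atTop atTop :=
    (tendsto_div_log_atTop.comp (tendsto_scaledIndex d m)).atTop_div_const hc
  have h1 := tendsto_nat_ceil_div_atTop.comp h0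
  have h2 := ((tendsto_scaledIndex_div d m).div (tendsto_log_scaledIndex_div d m)
    one_ne_zero).div_const (8 * ((d : ℝ) + 1))
  refine IsTheta.symm <| isTheta_of_div_tendsto_nhds_ne_zero (c := 1 * (1 / (2 * ((d : ℝ) + 1)) / 1
    / (8 * ((d : ℝ) + 1)))) ((h1.mul h2).congr' ?_) (by positivity)
  filter_upwards [eventually_gt_atTop 1, h0.eventually_gt_atTop 0] with i hi hpos
  have hl : 0 < Real.log i := Real.log_pos (by exact_mod_cast hi)
  have hi0 : (i : ℝ) ≠ 0 := by positivity
  simp only [Function.comp_apply, ← sampleSize_eq, Pi.div_apply]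
  have hl' : Real.log (scaledIndex d m i) ≠ 0 := by
    intro h; simp [h] at hpos
  have hy : scaledIndex d m i ≠ 0 := by
    intro h; simp [h] at hpos
  field_simp

lemma samplesBefore_mono (s : ℕ → ℕ) : Monotone (samplesBefore s) := by
  intro i j hij
  exact Finset.sum_le_sum_of_subset (Finset.range_subset_range.2 hij)

lemma one_le_M1 (d m : ℕ) (L μ : ℝ) : 1 ≤ M1 d m L μ := by
  have h : (d : ℝ) + 1 ≤ M1 d m L μ := le_max_left _ _
  have : (0 : ℝ) ≤ d := by positivity
  linarith

section Params

variable {d m : ℕ} (hm : 2 * Real.exp 1 * ((d : ℝ) + 1) ≤ (m : ℝ) + 1)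

lemma roundStep_pos {L μ : ℝ} (hμ : 0 < μ) (i : ℕ) : 0 < roundStep d m L μ i := by
  have := one_le_M1 d m L μ
  unfold roundStep
  positivity

include hm

lemma roundStep_antitone {L μ : ℝ} (hμ : 0 < μ) : Antitone (roundStep d m L μ) := by
  intro i j hij
  have := one_le_M1 d m L μ
  have hσ : (samplesBefore (sampleSize d m) i : ℝ) ≤ samplesBefore (sampleSize d m) j := by
    exact_mod_cast samplesBefore_mono _ hij
  have he := exp_one_le_M0 hm
  have h0 : (0 : ℝ) ≤ samplesBefore (sampleSize d m) i := by positivity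
  have h := monotoneOn_div_log (a := M0 m + samplesBefore (sampleSize d m) i)
    (b := M0 m + samplesBefore (sampleSize d m) j)
    (Set.mem_Ici.2 (by linarith)) (Set.mem_Ici.2 (by linarith)) (by linarith)
  unfold roundStep
  gcongr

lemma roundStep_isBigO {L μ : ℝ} (hμ : 0 < μ) :
    roundStep d m L μ =O[atTop] fun i : ℕ => Real.log i / (i : ℝ) ^ 2 := by
  refine IsBigO.of_bound (12 / μ * (128 * ((d : ℝ) + 1) ^ 2)) ?_
  filter_upwards [eventually_ge_atTop 2,
    (tendsto_log_scaledIndex_div d m).eventually_le_const (one_lt_two)] with i hi hlog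
  have hM := one_le_M1 d m L μ
  have hl : 0 < Real.log i := Real.log_pos (by exact_mod_cast hi)
  have hi0 : (2 : ℝ) ≤ i := by exact_mod_cast hi
  rw [div_le_iff₀ hl] at hlog
  rw [Real.norm_of_nonneg (roundStep_pos hμ i).le, Real.norm_of_nonneg (by positivity),
    roundStep, mul_assoc]
  refine mul_le_mul_of_nonneg_left ?_ (by positivity)
  have h1 := samplesBefore_lower hm (k := i) (i := i) (by omega)
  have hly := one_le_log_scaledIndex hm i
  have h2 : (i : ℝ) ^ 2 / (128 * ((d : ℝ) + 1) ^ 2 * Real.log i)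
      ≤ samplesBefore (sampleSize d m) i := by
    refine le_trans ?_ h1
    rw [div_le_div_iff₀ (by positivity) (by positivity)]
    have hn : (i : ℝ) ^ 2 / 4 ≤ (i : ℝ) * ((m : ℝ) + 1) + i * ((i : ℝ) - 1) / 2 := by
      have : (0 : ℝ) ≤ m := by positivity
      nlinarith
    calc (i : ℝ) ^ 2 * (16 * ((d : ℝ) + 1) ^ 2 * Real.log (scaledIndex d m i))
        ≤ (i : ℝ) ^ 2 * (16 * ((d : ℝ) + 1) ^ 2 * (2 * Real.log i)) := by gcongr
      _ = (i : ℝ) ^ 2 / 4 * (128 * ((d : ℝ) + 1) ^ 2 * Real.log i) := by ring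
      _ ≤ _ := by gcongr
  have h3 : 0 < (i : ℝ) ^ 2 / (128 * ((d : ℝ) + 1) ^ 2 * Real.log i) := by positivity
  calc _ ≤ 1 / ((i : ℝ) ^ 2 / (128 * ((d : ℝ) + 1) ^ 2 * Real.log i)) := by
        refine one_div_le_one_div_of_le h3 ?_
        have := Real.sqrt_nonneg ((M0 m + (samplesBefore (sampleSize d m) i : ℝ))
          / Real.log (M0 m + (samplesBefore (sampleSize d m) i : ℝ)))
        linarith
    _ = _ := by rw [one_div_div, mul_div_assoc]

end Params

/-! ### The delay and the offset in the step sizes -/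

/-- `2 M₁ + √((M₀ + x) / ln (M₀ + x))`, the quantity added to the number of samples in the
denominators of the step sizes and of the rate. -/
def offset (d m : ℕ) (L μ : ℝ) (x : ℝ) : ℝ :=
  2 * M1 d m L μ + Real.sqrt ((M0 m + x) / Real.log (M0 m + x))

lemma tendsto_M0_add (m : ℕ) : Tendsto (fun x : ℝ => M0 m + x) atTop atTop :=
  tendsto_atTop_add_const_left _ _ tendsto_id

lemma tendsto_sqrt_div_log_sq_div (m : ℕ) :
    Tendsto (fun x : ℝ => Real.sqrt ((M0 m + x) / Real.log (M0 m + x)) ^ 2 / x) atTop (𝓝 0) := by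
  have h1 : Tendsto (fun x : ℝ => 1 / Real.log (M0 m + x)) atTop (𝓝 0) :=
    tendsto_const_nhds.div_atTop (Real.tendsto_log_atTop.comp (tendsto_M0_add m))
  have h2 : Tendsto (fun x : ℝ => M0 m / x + 1) atTop (𝓝 (0 + 1)) :=
    (tendsto_const_nhds.div_atTop tendsto_id).add_const 1
  have h3 := h2.mul h1
  rw [mul_zero] at h3
  refine h3.congr' ?_
  filter_upwards [eventually_gt_atTop 0, (tendsto_M0_add m).eventually_gt_atTop 1] with x hx hx1
  have := Real.log_pos hx1
  rw [Real.sq_sqrt (by positivity)]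
  field_simp

lemma tendsto_offset (d m : ℕ) (L μ : ℝ) : Tendsto (offset d m L μ) atTop atTop :=
  tendsto_atTop_add_const_left _ _
    (Real.tendsto_sqrt_atTop.comp (tendsto_div_log_atTop.comp (tendsto_M0_add m)))

/-- A function whose square is negligible against `x` stays so after adding a constant. -/
lemma tendsto_const_add_sq_div {f : ℝ → ℝ}
    (hf : Tendsto (fun x => f x ^ 2 / x) atTop (𝓝 0)) (c : ℝ) :
    Tendsto (fun x => (c + f x) ^ 2 / x) atTop (𝓝 0) := by
  have h1 : Tendsto (fun x : ℝ => 2 * c ^ 2 / x) atTop (𝓝 0) :=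
    tendsto_const_nhds.div_atTop tendsto_id
  have h2 := h1.add (hf.const_mul 2)
  rw [mul_zero, add_zero] at h2
  refine squeeze_zero' ?_ ?_ h2
  · filter_upwards [eventually_gt_atTop 0] with x hx
    positivity
  · filter_upwards [eventually_gt_atTop 0] with x hx
    have : 2 * c ^ 2 / x + 2 * (f x ^ 2 / x) = (2 * c ^ 2 + 2 * f x ^ 2) / x := by ring
    rw [this]
    gcongr
    nlinarith [sq_nonneg (c - f x)]

lemma tendsto_offset_sq_div (d m : ℕ) (L μ : ℝ) :
    Tendsto (fun x => offset d m L μ x ^ 2 / x) atTop (𝓝 0) :=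
  tendsto_const_add_sq_div (tendsto_sqrt_div_log_sq_div m) _

/-- A function whose square is negligible against `x` is itself negligible against `x`. -/
lemma tendsto_div_of_sq_div {f : ℝ → ℝ} (hf : Tendsto (fun x => f x ^ 2 / x) atTop (𝓝 0)) :
    Tendsto (fun x => f x / x) atTop (𝓝 0) := by
  have h := hf.div_atTop tendsto_id
  have h2 := (Real.continuous_sqrt.tendsto 0).comp h
  rw [Real.sqrt_zero] at h2
  refine (tendsto_zero_iff_abs_tendsto_zero _).2 (h2.congr' ?_)
  filter_upwards [eventually_gt_atTop 0] with x hx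
  simp only [Function.comp_apply, id]
  rw [div_div, ← sq, ← div_pow, Real.sqrt_sq_eq_abs]

lemma tendsto_offset_div (d m : ℕ) (L μ : ℝ) :
    Tendsto (fun x => offset d m L μ x / x) atTop (𝓝 0) :=
  tendsto_div_of_sq_div (tendsto_offset_sq_div d m L μ)

lemma delay_eq (d m : ℕ) (L μ x : ℝ) : delay d m L μ x
    = M1 d m L μ + Real.sqrt ((M0 m + x) / Real.log (M0 m + x)) / 2 := by
  unfold delay
  congr 1
  rw [add_comm x, mul_comm 4, ← div_div, Real.sqrt_div' _ (by norm_num)]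
  congr 1
  rw [show (4 : ℝ) = 2 ^ 2 by norm_num, Real.sqrt_sq (by norm_num)]

lemma tendsto_const_add_delay_sq_div (d m : ℕ) (L μ c : ℝ) :
    Tendsto (fun x => (c + delay d m L μ x) ^ 2 / x) atTop (𝓝 0) := by
  have h := (tendsto_sqrt_div_log_sq_div m).const_mul (1 / 4)
  rw [mul_zero] at h
  have h2 := tendsto_const_add_sq_div (h.congr fun x => show _ =
    (Real.sqrt ((M0 m + x) / Real.log (M0 m + x)) / 2) ^ 2 / x by ring) (c + M1 d m L μ)
  refine h2.congr fun x => ?_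
  rw [delay_eq, add_assoc]

/-- A bound `⌈τ t⌉` on the number of most recent updates that a read in iteration `t` may miss. -/
def window (d m : ℕ) (L μ : ℝ) (t : ℕ) : ℕ := ⌈delay d m L μ t⌉₊

lemma delay_nonneg (d m : ℕ) (L μ x : ℝ) : 0 ≤ delay d m L μ x := by
  have := one_le_M1 d m L μ
  unfold delay
  positivity

lemma tendsto_window_sq_div (d m : ℕ) (L μ : ℝ) :
    Tendsto (fun t : ℕ => (window d m L μ t : ℝ) ^ 2 / t) atTop (𝓝 0) := by
  have h := (tendsto_const_add_delay_sq_div d m L μ 1).comp (tendsto_natCast_atTop_atTop (R := ℝ))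
  refine squeeze_zero (fun t => by positivity) (fun t => ?_) h
  simp only [Function.comp_apply]
  gcongr
  rw [add_comm]
  exact (Nat.ceil_lt_add_one (delay_nonneg d m L μ t)).le

/-! ### The step sizes of the iterations -/

section Params

variable {d m : ℕ} (hm : 2 * Real.exp 1 * ((d : ℝ) + 1) ≤ (m : ℝ) + 1)

include hm

lemma le_samplesBefore (i : ℕ) : i ≤ samplesBefore (sampleSize d m) i := by
  unfold samplesBefore
  calc i = ∑ j ∈ Finset.range i, 1 := by simp
    _ ≤ _ := Finset.sum_le_sum fun j _ => sampleSize_pos hm j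

lemma lt_samplesBefore_roundOf (t : ℕ) :
    t < samplesBefore (sampleSize d m) (roundOf (sampleSize d m) t + 1) :=
  Nat.sInf_mem (s := {i | t < samplesBefore (sampleSize d m) (i + 1)})
    ⟨t, lt_of_lt_of_le t.lt_succ_self (le_samplesBefore hm _)⟩

omit hm in
lemma samplesBefore_roundOf_le (t : ℕ) :
    samplesBefore (sampleSize d m) (roundOf (sampleSize d m) t) ≤ t := by
  rcases h : roundOf (sampleSize d m) t with _ | i
  · simp [samplesBefore]
  · have : i ∉ {i | t < samplesBefore (sampleSize d m) (i + 1)} :=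
      Nat.notMem_of_lt_sInf (by change i < roundOf (sampleSize d m) t; omega)
    simpa using this

/-- A round eventually contains at most a tenth of the samples so far: by the delay condition its
size is bounded by the delay function, which is sublinear. -/
lemma eventually_le_samplesBefore_roundOf (L μ : ℝ) : ∀ᶠ t : ℕ in atTop,
    9 / 10 * (t : ℝ) ≤ samplesBefore (sampleSize d m) (roundOf (sampleSize d m) t) := by
  have hτ : ∀ᶠ x : ℝ in atTop, delay d m L μ x ≤ x / 10 := by
    have h := tendsto_div_of_sq_div ((tendsto_const_add_delay_sq_div d m L μ 0).congr
      fun x => by rw [zero_add])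
    filter_upwards [h.eventually_le_const (show (0 : ℝ) < 1 / 10 by norm_num),
      eventually_gt_atTop 0] with x hx hx0
    rw [div_le_iff₀ hx0] at hx
    linarith
  obtain ⟨X, hX⟩ := eventually_atTop.1 hτ
  filter_upwards [tendsto_natCast_atTop_atTop.eventually_ge_atTop X,
    eventually_ge_atTop (samplesBefore (sampleSize d m) (d + 1))] with t ht htd
  set i := roundOf (sampleSize d m) t with hi
  have h1 := lt_samplesBefore_roundOf hm t
  rw [← hi] at h1
  have hid : d + 1 ≤ i := by
    by_contra hcon
    have := samplesBefore_mono (sampleSize d m) (show i + 1 ≤ d + 1 by omega)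
    omega
  have h2 := delayCondition hm L μ i hid
  rw [sum_Icc_eq_samplesBefore] at h2
  have h3 : (sampleSize d m i : ℝ) ≤ ((∑ j ∈ Finset.Icc (i - d) i, sampleSize d m j : ℕ) : ℝ) := by
    exact_mod_cast Finset.single_le_sum (f := sampleSize d m) (fun _ _ => Nat.zero_le _)
      (Finset.mem_Icc.2 ⟨Nat.sub_le _ _, le_rfl⟩)
  have h1' : (t : ℝ) < samplesBefore (sampleSize d m) (i + 1) := by exact_mod_cast h1
  have h4 := hX _ (ht.trans h1'.le)
  have h5 : (samplesBefore (sampleSize d m) (i + 1) : ℝ)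
      = samplesBefore (sampleSize d m) i + sampleSize d m i := by
    simp [samplesBefore, Finset.sum_range_succ]
  linarith

omit hm in
lemma stepSize_pos {L μ : ℝ} (hμ : 0 < μ) (t : ℕ) : 0 < stepSize d m L μ t :=
  roundStep_pos hμ _

lemma eventually_stepSize_le {L μ : ℝ} (hμ : 0 < μ) : ∀ᶠ t : ℕ in atTop,
    stepSize d m L μ t ≤ 14 / (μ * t) := by
  filter_upwards [eventually_le_samplesBefore_roundOf hm L μ, eventually_gt_atTop 0] with t ht ht0
  have hM := one_le_M1 d m L μ
  have ht' : (0 : ℝ) < t := by exact_mod_cast ht0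
  rw [stepSize, roundStep]
  have : 14 / (μ * t) = 12 / μ * (1 / (6 / 7 * t)) := by field_simp; norm_num
  rw [this]
  gcongr
  have := Real.sqrt_nonneg ((M0 m + samplesBefore (sampleSize d m) (roundOf (sampleSize d m) t))
    / Real.log (M0 m + samplesBefore (sampleSize d m) (roundOf (sampleSize d m) t)))
  linarith

lemma eventually_le_stepSize {L μ : ℝ} (hμ : 0 < μ) : ∀ᶠ t : ℕ in atTop,
    10 / (μ * t) ≤ stepSize d m L μ t := by
  have h := (tendsto_offset_div d m L μ).comp (tendsto_natCast_atTop_atTop (R := ℝ))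
  filter_upwards [eventually_gt_atTop 0,
    h.eventually_le_const (show (0 : ℝ) < 1 / 5 by norm_num)] with t ht0 ht
  have hM := one_le_M1 d m L μ
  have ht' : (0 : ℝ) < t := by exact_mod_cast ht0
  simp only [Function.comp_apply] at ht
  rw [div_le_iff₀ ht', offset] at ht
  rw [stepSize, roundStep]
  have hσ : (samplesBefore (sampleSize d m) (roundOf (sampleSize d m) t) : ℝ) ≤ t := by
    exact_mod_cast samplesBefore_roundOf_le t
  have he := exp_one_le_M0 hm
  have h0 : (0 : ℝ) ≤ samplesBefore (sampleSize d m) (roundOf (sampleSize d m) t) := by positivity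
  have hs := Real.sqrt_le_sqrt (monotoneOn_div_log
    (a := M0 m + samplesBefore (sampleSize d m) (roundOf (sampleSize d m) t)) (b := M0 m + t)
    (Set.mem_Ici.2 (by linarith)) (Set.mem_Ici.2 (by linarith)) (by linarith))
  have : 10 / (μ * t) = 12 / μ * (1 / (6 / 5 * t)) := by field_simp; norm_num
  rw [this]
  gcongr
  linarith

end Params

/-! ### Asymptotics of the guaranteed rate -/

lemma rate_eq (d m : ℕ) (L μ N : ℝ) (t : ℕ) : rate d m L μ N t =
    8 * 36 ^ 2 * N / μ ^ 2 * ((t : ℝ) / ((t : ℝ) + (offset d m L μ t - 1)) ^ 2) := by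
  rw [rate, offset]
  congr 4
  ring

lemma tendsto_mul_rate (d m : ℕ) (L μ N : ℝ) :
    Tendsto (fun t : ℕ => (t : ℝ) * rate d m L μ N t) atTop (𝓝 (8 * 36 ^ 2 * N / μ ^ 2)) := by
  have h := (tendsto_offset_div d m L μ).comp (tendsto_natCast_atTop_atTop (R := ℝ))
  have h1 : Tendsto (fun t : ℕ => (1 : ℝ) / t) atTop (𝓝 0) :=
    tendsto_const_div_atTop_nhds_zero_nat _
  have h2 := ((((h.sub h1).const_add 1).pow 2).inv₀ (by norm_num)).const_mul
    (8 * 36 ^ 2 * N / μ ^ 2)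
  rw [sub_zero, add_zero, one_pow, inv_one, mul_one] at h2
  refine h2.congr' ?_
  filter_upwards [eventually_gt_atTop 0] with t ht
  have ht' : (t : ℝ) ≠ 0 := by positivity
  rw [rate_eq, Function.comp_apply]
  have : 1 + (offset d m L μ t / t - 1 / t) = (t + (offset d m L μ t - 1)) / t := by
    field_simp
  rw [this, div_pow, inv_div]
  ring

/-- The rate beats its leading term by every relative correction `g t / t` for which `g` is
eventually dominated by the offset. -/
lemma eventually_rate_le (d m : ℕ) (L : ℝ) {μ N : ℝ} (hN : 0 < N) (hμ : 0 < μ) {g : ℕ → ℝ}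
    (hg : ∀ᶠ t : ℕ in atTop, 2 * g t ≤ offset d m L μ t - 1) :
    ∀ᶠ t : ℕ in atTop, rate d m L μ N t ≤
      8 * 36 ^ 2 * N / μ ^ 2 * (1 / (t : ℝ)) * (1 - g t / t) := by
  have h := (tendsto_offset_div d m L μ).comp (tendsto_natCast_atTop_atTop (R := ℝ))
  have h' := (tendsto_offset d m L μ).comp (tendsto_natCast_atTop_atTop (R := ℝ))
  filter_upwards [eventually_gt_atTop 0, h.eventually_le_const one_pos, hg,
    h'.eventually_ge_atTop 1] with t ht0 ht hgt h1
  have ht' : (0 : ℝ) < t := by exact_mod_cast ht0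
  simp only [Function.comp_apply] at ht h1
  rw [div_le_iff₀ ht', one_mul] at ht
  rw [rate_eq, mul_assoc (8 * 36 ^ 2 * N / μ ^ 2)]
  refine mul_le_mul_of_nonneg_left ?_ (by positivity)
  set e := offset d m L μ t - 1 with he
  have he0 : 0 ≤ e := by linarith
  have het : e ≤ t := by linarith
  have hx : 1 - e / (2 * t) ≤ 1 - g t / t := by
    have : g t / t ≤ e / (2 * t) := by
      rw [div_le_div_iff₀ ht' (by positivity)]
      nlinarith
    linarith
  refine le_trans ?_ (mul_le_mul_of_nonneg_left hx (one_div_nonneg.2 ht'.le))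
  have : 1 / (t : ℝ) * (1 - e / (2 * t)) = (2 * t - e) / (2 * t ^ 2) := by field_simp
  rw [this, div_le_div_iff₀ (by positivity) (by positivity)]
  have : (2 * t - e) * (t + e) ^ 2 - t * (2 * t ^ 2) = e * (3 * t ^ 2 - e ^ 2) := by ring
  have h3 : 0 ≤ e * (3 * t ^ 2 - e ^ 2) := mul_nonneg he0 (by nlinarith)
  linarith

/-! ### A scalar recursion with delays -/

/-- The system of inequalities satisfied by the second moments of a run: `a t` stands for
`𝔼 ‖w t - w⋆‖²`, `b t` for `𝔼 ‖ŵ t - w t‖²` and `G t` for the second moment of the gradient used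
in iteration `t`. The read error `b t` is made up of the at most `n t` most recent updates. -/
structure DelayedRecursion (η : ℕ → ℝ) (n : ℕ → ℕ) (L μ N R : ℝ) (a b G : ℕ → ℝ) : Prop where
  a_nonneg : ∀ t, 0 ≤ a t
  b_nonneg : ∀ t, 0 ≤ b t
  G_nonneg : ∀ t, 0 ≤ G t
  init : a 0 ≤ R ^ 2
  step : ∀ t, a (t + 1) ≤ (1 - μ * η t / 4) * a t + (μ / 2 + 2 * L ^ 2 / μ) * η t * b t
    + η t ^ 2 * G t
  grad : ∀ t, G t ≤ 4 * L ^ 2 * (a t + b t) + N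
  read : ∀ t, b t ≤ n t * ∑ j ∈ Finset.Ico (t - n t) t, η j ^ 2 * G j

section Recursion

variable {η : ℕ → ℝ} {n : ℕ → ℕ} {L μ N R : ℝ}

/-- Up to any given time the solutions are bounded in terms of the data only. -/
lemma DelayedRecursion.exists_bound_upto (hη : ∀ t, 0 < η t) (hμ : 0 < μ) (hN : 0 < N) (T : ℕ) :
    ∃ c : ℝ, ∀ a b G, DelayedRecursion η n L μ N R a b G →
      ∀ t ≤ T, a t ≤ c ∧ b t ≤ c ∧ G t ≤ c := by
  induction T with
  | zero =>
    refine ⟨R ^ 2 + (4 * L ^ 2 * R ^ 2 + N), fun a b G h t ht => ?_⟩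
    obtain rfl : t = 0 := by omega
    have h1 := h.init
    have h2 : b 0 ≤ 0 := by simpa using h.read 0
    have h3 := h.grad 0
    have h4 : 4 * L ^ 2 * (a 0 + b 0) ≤ 4 * L ^ 2 * R ^ 2 := by
      gcongr; linarith
    have h5 : 0 ≤ 4 * L ^ 2 * R ^ 2 := by positivity
    have h6 : 0 ≤ R ^ 2 := by positivity
    refine ⟨?_, ?_, ?_⟩ <;> linarith
  | succ T ih =>
    obtain ⟨c, hc⟩ := ih
    set K := μ / 2 + 2 * L ^ 2 / μ with hK
    have hK0 : 0 ≤ K := by positivity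
    set A := c + K * η T * c + η T ^ 2 * c with hA
    set C := n (T + 1) * ∑ j ∈ Finset.Ico (T + 1 - n (T + 1)) (T + 1), η j ^ 2 * c with hC
    refine ⟨|c| + |A| + |C| + (4 * L ^ 2 * (|A| + |C|) + N), fun a b G h t ht => ?_⟩
    have p1 : 0 ≤ 4 * L ^ 2 * (|A| + |C|) := by positivity
    have p2 := abs_nonneg A
    have p3 := abs_nonneg C
    have p4 := abs_nonneg c
    rcases Nat.lt_or_ge t (T + 1) with hlt | hge
    · obtain ⟨h1, h2, h3⟩ := hc a b G h t (by omega)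
      have := le_abs_self c
      refine ⟨?_, ?_, ?_⟩ <;> linarith
    · obtain rfl : t = T + 1 := by omega
      obtain ⟨h1, h2, h3⟩ := hc a b G h T le_rfl
      have ha : a (T + 1) ≤ A := by
        have hs := h.step T
        rw [← hK] at hs
        have e1 : (1 - μ * η T / 4) * a T ≤ c := by
          have : 0 ≤ μ * η T / 4 * a T :=
            mul_nonneg (div_nonneg (mul_nonneg hμ.le (hη T).le) (by norm_num)) (h.a_nonneg T)
          linarith
        have e2 : K * η T * b T ≤ K * η T * c :=
          mul_le_mul_of_nonneg_left h2 (mul_nonneg hK0 (hη T).le)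
        have e3 : η T ^ 2 * G T ≤ η T ^ 2 * c := by gcongr
        linarith
      have hb : b (T + 1) ≤ C := by
        refine (h.read (T + 1)).trans ?_
        rw [hC]
        gcongr with j hj
        exact (hc a b G h j (by have := (Finset.mem_Ico.1 hj).2; omega)).2.2
      have ha' := ha.trans (le_abs_self A)
      have hb' := hb.trans (le_abs_self C)
      have hG := h.grad (T + 1)
      have : 4 * L ^ 2 * (a (T + 1) + b (T + 1)) ≤ 4 * L ^ 2 * (|A| + |C|) := by gcongr
      refine ⟨?_, ?_, ?_⟩ <;> linarith

/-- Eventually the whole window of missed updates lies in the second half of the past, where the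
step sizes are of order `1 / t`. -/
lemma DelayedRecursion.eventually_read_le (hη : ∀ t, 0 < η t) (hμ : 0 < μ)
    (hη_le : ∀ᶠ t : ℕ in atTop, η t ≤ 14 / (μ * t))
    (hn : Tendsto (fun t : ℕ => (n t : ℝ) ^ 2 / t) atTop (𝓝 0)) :
    ∀ᶠ t : ℕ in atTop, ∀ a b G, DelayedRecursion η n L μ N R a b G → ∀ M : ℝ,
      (∀ j < t, G j ≤ M) → b t ≤ 784 / μ ^ 2 * ((n t : ℝ) ^ 2 / t) * (M / t) := by
  obtain ⟨T, hT⟩ := eventually_atTop.1 hη_le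
  filter_upwards [hn.eventually_le_const (show (0 : ℝ) < 1 / 2 by norm_num),
    eventually_ge_atTop (2 * T), eventually_gt_atTop 0] with t hnt htT ht0 a b G h M hM
  have ht' : (0 : ℝ) < t := by exact_mod_cast ht0
  rw [div_le_iff₀ ht'] at hnt
  have hn1 : (n t : ℝ) ≤ (n t : ℝ) ^ 2 := by exact_mod_cast Nat.le_self_pow two_ne_zero _
  have hn2 : 2 * n t ≤ t := by
    have : 2 * (n t : ℝ) ≤ t := by linarith
    exact_mod_cast this
  have hM0 : 0 ≤ M := (h.G_nonneg 0).trans (hM 0 ht0)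
  have hterm : ∀ j ∈ Finset.Ico (t - n t) t, η j ^ 2 * G j ≤ (28 / (μ * t)) ^ 2 * M := by
    intro j hj
    obtain ⟨hj1, hj2⟩ := Finset.mem_Ico.1 hj
    have hj3 : t ≤ 2 * j := by omega
    have hj4 : (t : ℝ) ≤ 2 * j := by exact_mod_cast hj3
    have h1 : η j ≤ 28 / (μ * t) := by
      refine (hT j (by omega)).trans ?_
      have hj0 : (0 : ℝ) < j := by linarith
      rw [div_le_div_iff₀ (by positivity) (by positivity)]
      nlinarith
    have h2 := hM j hj2
    have h3 := h.G_nonneg j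
    have h4 := (hη j).le
    gcongr
  refine (h.read t).trans ?_
  have hsum := Finset.sum_le_card_nsmul _ _ _ hterm
  rw [Nat.card_Ico, nsmul_eq_mul, Nat.sub_sub_self (by omega)] at hsum
  calc (n t : ℝ) * ∑ j ∈ Finset.Ico (t - n t) t, η j ^ 2 * G j
      ≤ n t * (n t * ((28 / (μ * t)) ^ 2 * M)) := by gcongr
    _ = _ := by ring

/-- All solutions are bounded by a constant that depends on the data only. -/
lemma DelayedRecursion.exists_bound (hη : ∀ t, 0 < η t) (hL : 0 < L) (hμ : 0 < μ) (hN : 0 < N)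
    (hη_le : ∀ᶠ t : ℕ in atTop, η t ≤ 14 / (μ * t))
    (hn : Tendsto (fun t : ℕ => (n t : ℝ) ^ 2 / t) atTop (𝓝 0)) :
    ∃ B : ℝ, 0 < B ∧ ∀ a b G, DelayedRecursion η n L μ N R a b G →
      ∀ t, a t ≤ B ∧ b t ≤ B ∧ G t ≤ 9 * L ^ 2 * B := by
  set K := μ / 2 + 2 * L ^ 2 / μ with hK
  have hK0 : 0 < K := by positivity
  have hinv : Tendsto (fun t : ℕ => (1 : ℝ) / t) atTop (𝓝 0) :=
    tendsto_const_div_atTop_nhds_zero_nat _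
  -- If `B ≥ N / L²` bounds the past, then `9 L² B` bounds its gradients. The next two limits make
  -- the read error relative to `B`, and the step size, small compared with the contraction.
  have lim1 : Tendsto (fun t : ℕ => 784 / μ ^ 2 * ((n t : ℝ) ^ 2 / t) * (9 * L ^ 2 * (1 / t)))
      atTop (𝓝 0) := by
    simpa using (hn.const_mul (784 / μ ^ 2)).mul (hinv.const_mul (9 * L ^ 2))
  have lim2 : Tendsto (fun t : ℕ => 14 / μ * (1 / (t : ℝ))) atTop (𝓝 0) := by
    simpa using hinv.const_mul (14 / μ)
  have hev := (((DelayedRecursion.eventually_read_le (L := L) (N := N) (R := R) hη hμ hη_le hn).and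
    hη_le).and ((lim1.eventually_le_const one_pos).and (lim1.eventually_le_const
      (show 0 < μ / (8 * K) by positivity)))).and
    ((lim2.eventually_le_const (show 0 < 4 / μ by positivity)).and
      (lim2.eventually_le_const (show 0 < μ / (72 * L ^ 2) by positivity)))
  obtain ⟨T, hT⟩ := eventually_atTop.1 hev
  obtain ⟨c, hc⟩ := DelayedRecursion.exists_bound_upto (n := n) (L := L) (R := R) hη hμ hN T
  set B := max c (N / L ^ 2) with hB
  have hB0 : 0 < B := lt_max_of_lt_right (by positivity)
  have hNB : N ≤ L ^ 2 * B := by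
    have : N / L ^ 2 ≤ B := le_max_right _ _
    rwa [div_le_iff₀ (by positivity), mul_comm] at this
  refine ⟨B, hB0, fun a b G h => ?_⟩
  have hG : ∀ t, a t ≤ B → b t ≤ B → G t ≤ 9 * L ^ 2 * B := by
    intro t h1 h2
    have : 4 * L ^ 2 * (a t + b t) ≤ 4 * L ^ 2 * (B + B) := by gcongr
    linarith [h.grad t]
  suffices hab : ∀ t, a t ≤ B ∧ b t ≤ B from
    fun t => ⟨(hab t).1, (hab t).2, hG t (hab t).1 (hab t).2⟩
  intro t
  induction t using Nat.strong_induction_on with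
  | _ t ih =>
    rcases Nat.lt_or_ge T t with hlt | hge
    swap
    · obtain ⟨h1, h2, -⟩ := hc a b G h t hge
      exact ⟨h1.trans (le_max_left _ _), h2.trans (le_max_left _ _)⟩
    have hGj : ∀ j < t, G j ≤ 9 * L ^ 2 * B := fun j hj => hG j (ih j hj).1 (ih j hj).2
    have hbs : ∀ s, T ≤ s → s ≤ t →
        b s ≤ 784 / μ ^ 2 * ((n s : ℝ) ^ 2 / s) * (9 * L ^ 2 * (1 / s)) * B := by
      intro s hs hst
      refine ((hT s hs).1.1.1 a b G h _ fun j hj => hGj j (by omega)).trans (le_of_eq ?_)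
      ring
    obtain ⟨s, rfl⟩ : ∃ s, t = s + 1 := ⟨t - 1, by omega⟩
    obtain ⟨⟨⟨-, hηs⟩, -, hs2⟩, hs3, hs4⟩ := hT s (by omega)
    obtain ⟨⟨-, hs1, -⟩, -⟩ := hT (s + 1) (by omega)
    have hηs' : η s ≤ 14 / μ * (1 / (s : ℝ)) :=
      hηs.trans (le_of_eq (by rw [div_mul_div_comm, mul_one]))
    have hη0 := hη s
    refine ⟨?_, (hbs _ (by omega) le_rfl).trans (mul_le_of_le_one_left hB0.le hs1)⟩
    have e1 : (1 - μ * η s / 4) * a s ≤ (1 - μ * η s / 4) * B := by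
      refine mul_le_mul_of_nonneg_left (ih s (by omega)).1 ?_
      have := hηs'.trans hs3
      rw [le_div_iff₀ hμ] at this
      linarith
    have e2 : K * η s * b s ≤ μ * η s / 8 * B := by
      have h1 : b s ≤ μ / (8 * K) * B :=
        (hbs s (by omega) (by omega)).trans (mul_le_mul_of_nonneg_right hs2 hB0.le)
      calc K * η s * b s ≤ K * η s * (μ / (8 * K) * B) := by gcongr
        _ = _ := by field_simp
    have e3 : η s ^ 2 * G s ≤ μ * η s / 8 * B := by
      have h1 := hηs'.trans hs4
      rw [le_div_iff₀ (by positivity)] at h1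
      have h2 := hGj s (by omega)
      calc η s ^ 2 * G s ≤ η s ^ 2 * (9 * L ^ 2 * B) := by gcongr
        _ = η s * (η s * (72 * L ^ 2)) * B / 8 := by ring
        _ ≤ η s * μ * B / 8 := by gcongr
        _ = _ := by ring
    have hs := h.step s
    rw [← hK] at hs
    linarith

/-- A contraction by `1 - 2 / t` with noise `Q / t²` has rate `Q / t`. -/
lemma le_of_contraction {x : ℕ → ℝ} {Q : ℝ} {T : ℕ} (hT : 2 ≤ T)
    (hx : ∀ t, T ≤ t → x (t + 1) ≤ (1 - 2 / (t : ℝ)) * x t + Q / (t : ℝ) ^ 2) (hQ : 0 ≤ Q) :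
    ∀ t, T ≤ t → ((t : ℝ) - 1) * (t - 2) * x t ≤ ((T : ℝ) - 1) * (T - 2) * x T + Q * t := by
  intro t ht
  induction t, ht using Nat.le_induction with
  | base =>
    have : 0 ≤ Q * (T : ℝ) := by positivity
    linarith
  | succ t ht ih =>
    have h2 : (2 : ℝ) ≤ t := by exact_mod_cast hT.trans ht
    have h0 : (t : ℝ) ≠ 0 := by positivity
    push_cast
    have h1 : ((t : ℝ) * (t - 1)) * x (t + 1)
        ≤ ((t : ℝ) * (t - 1)) * ((1 - 2 / (t : ℝ)) * x t + Q / (t : ℝ) ^ 2) :=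
      mul_le_mul_of_nonneg_left (hx t ht) (mul_nonneg (by linarith) (by linarith))
    have e : ((t : ℝ) * (t - 1)) * ((1 - 2 / (t : ℝ)) * x t + Q / (t : ℝ) ^ 2)
        = (t - 1) * (t - 2) * x t + Q - Q / t := by
      field_simp
      ring
    have : 0 ≤ Q / (t : ℝ) := by positivity
    have e' : ((t : ℝ) + 1 - 1) * (t + 1 - 2) = t * (t - 1) := by ring
    rw [e']
    linarith

/-- The scalar form of the convergence theorem: once the solutions are known to be bounded, the
read errors are `o (1 / t)`, so that only the gradient noise at the minimizer remains. -/
theorem DelayedRecursion.eventually_le (hη : ∀ t, 0 < η t) (hL : 0 < L) (hμ : 0 < μ) (hN : 0 < N)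
    (hη_le : ∀ᶠ t : ℕ in atTop, η t ≤ 14 / (μ * t))
    (hη_ge : ∀ᶠ t : ℕ in atTop, 10 / (μ * t) ≤ η t)
    (hn : Tendsto (fun t : ℕ => (n t : ℝ) ^ 2 / t) atTop (𝓝 0)) :
    ∀ᶠ t : ℕ in atTop, ∀ a b G, DelayedRecursion η n L μ N R a b G →
      2 * a t + 2 * b t ≤ 1000 * N / μ ^ 2 / t := by
  set K := μ / 2 + 2 * L ^ 2 / μ with hK
  have hK0 : 0 < K := by positivity
  obtain ⟨B, hB0, hB⟩ := DelayedRecursion.exists_bound (R := R) hη hL hμ hN hη_le hn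
  set M := 9 * L ^ 2 * B with hM
  have hM0 : 0 < M := by positivity
  set Q := 200 * N / μ ^ 2 with hQ
  have hQ0 : 0 < Q := by positivity
  have hinv : Tendsto (fun t : ℕ => (1 : ℝ) / t) atTop (𝓝 0) :=
    tendsto_const_div_atTop_nhds_zero_nat _
  have lim1 : Tendsto (fun t : ℕ => 784 / μ ^ 2 * ((n t : ℝ) ^ 2 / t) * M) atTop (𝓝 0) := by
    simpa using (hn.const_mul (784 / μ ^ 2)).mul_const M
  have lim2 : Tendsto (fun t : ℕ => 14 / μ * (1 / (t : ℝ))) atTop (𝓝 0) := by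
    simpa using hinv.const_mul (14 / μ)
  have hread := DelayedRecursion.eventually_read_le (L := L) (N := N) (R := R) hη hμ hη_le hn
  have hb : ∀ ε > 0, ∀ᶠ t : ℕ in atTop, ∀ a b G, DelayedRecursion η n L μ N R a b G →
      b t ≤ ε / t := by
    intro ε hε
    filter_upwards [hread, lim1.eventually_le_const hε] with t h1 h2 a b G h
    refine (h1 a b G h M fun j _ => (hB a b G h j).2.2).trans ?_
    rw [← mul_div_assoc]
    gcongr
  have hstep : ∀ᶠ t : ℕ in atTop, ∀ a b G, DelayedRecursion η n L μ N R a b G →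
      a (t + 1) ≤ (1 - 2 / (t : ℝ)) * a t + Q / (t : ℝ) ^ 2 := by
    filter_upwards [hb (N / (7 * μ * K)) (by positivity), hb (N / (392 * L ^ 2)) (by positivity),
      hη_le, hη_ge, lim2.eventually_le_const (show 0 < μ / (80 * L ^ 2) by positivity),
      eventually_gt_atTop 0] with t h1 h2 h3 h4 h5 ht0 a b G h
    have ht : (1 : ℝ) ≤ t := by exact_mod_cast ht0
    have hη0 := hη t
    have ha := h.a_nonneg t
    have h5' : η t * (80 * L ^ 2) ≤ μ := by
      rw [← le_div_iff₀ (by positivity)]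
      refine le_trans ?_ h5
      rwa [div_mul_div_comm, mul_one]
    -- the part of `G t` that grows with `a t` is paid for out of the contraction
    have e1 : 2 / (t : ℝ) * a t ≤ (μ * η t / 4 - 4 * L ^ 2 * η t ^ 2) * a t := by
      refine mul_le_mul_of_nonneg_right ?_ ha
      have : 2 / (t : ℝ) ≤ μ / 5 * η t := by
        calc 2 / (t : ℝ) = μ / 5 * (10 / (μ * t)) := by field_simp; norm_num
          _ ≤ _ := by gcongr
      nlinarith
    have e2 : K * η t * b t ≤ 2 * N / μ ^ 2 / (t : ℝ) ^ 2 := by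
      calc K * η t * b t ≤ K * (14 / (μ * t)) * (N / (7 * μ * K) / t) := by
            have := h1 a b G h
            have := h.b_nonneg t
            gcongr
        _ = _ := by field_simp; norm_num
    have hsq : η t ^ 2 ≤ 196 / μ ^ 2 / (t : ℝ) ^ 2 := by
      calc η t ^ 2 ≤ (14 / (μ * t)) ^ 2 := by gcongr
        _ = _ := by field_simp; norm_num
    have e3 : η t ^ 2 * (4 * L ^ 2 * b t + N) ≤ 198 * N / μ ^ 2 / (t : ℝ) ^ 2 := by
      have hb2 : b t ≤ N / (392 * L ^ 2) :=
        (h2 a b G h).trans (div_le_self (by positivity) ht)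
      calc η t ^ 2 * (4 * L ^ 2 * b t + N)
          ≤ 196 / μ ^ 2 / (t : ℝ) ^ 2 * (4 * L ^ 2 * (N / (392 * L ^ 2)) + N) := by
            have := h.b_nonneg t
            gcongr
        _ = _ := by field_simp; norm_num
    have e4 : η t ^ 2 * G t ≤ 4 * L ^ 2 * η t ^ 2 * a t + η t ^ 2 * (4 * L ^ 2 * b t + N) := by
      calc η t ^ 2 * G t ≤ η t ^ 2 * (4 * L ^ 2 * (a t + b t) + N) :=
            mul_le_mul_of_nonneg_left (h.grad t) (by positivity)
        _ = _ := by ring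
    have e5 : Q / (t : ℝ) ^ 2 = 2 * N / μ ^ 2 / (t : ℝ) ^ 2 + 198 * N / μ ^ 2 / (t : ℝ) ^ 2 := by
      rw [hQ]; ring
    have hs := h.step t
    rw [← hK] at hs
    linarith
  obtain ⟨T, hT⟩ := eventually_atTop.1 (hstep.and (eventually_ge_atTop 2))
  have hT2 : (2 : ℝ) ≤ T := by exact_mod_cast (hT T le_rfl).2
  set C := ((T : ℝ) - 1) * (T - 2) * B with hC
  filter_upwards [eventually_ge_atTop T, eventually_gt_atTop 2, hb (Q / 2) (by positivity),
    tendsto_natCast_atTop_atTop.eventually_ge_atTop ((6 * Q + C) / Q)]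
    with t htT ht2 hbt htQ a b G h
  have h1 := le_of_contraction (hT T le_rfl).2 (fun s hs => (hT s hs).1 a b G h) hQ0.le t htT
  have h2 : ((T : ℝ) - 1) * (T - 2) * a T ≤ C :=
    mul_le_mul_of_nonneg_left (hB a b G h T).1 (mul_nonneg (by linarith) (by linarith))
  have ht2' : (2 : ℝ) < t := by exact_mod_cast ht2
  have h3 : a t ≤ 2 * Q / t := by
    have hpos : 0 < ((t : ℝ) - 1) * (t - 2) := mul_pos (by linarith) (by linarith)
    rw [le_div_iff₀ (by linarith)]
    rw [div_le_iff₀ hQ0] at htQ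
    refine le_of_mul_le_mul_left ?_ hpos
    have h4 : ((t : ℝ) - 1) * (t - 2) * (a t * t) ≤ (C + Q * t) * t := by
      calc ((t : ℝ) - 1) * (t - 2) * (a t * t) = ((t : ℝ) - 1) * (t - 2) * a t * t := by ring
        _ ≤ _ := by gcongr; linarith
    nlinarith
  have h5 := hbt a b G h
  have e : 1000 * N / μ ^ 2 / (t : ℝ) = 2 * (2 * Q / t) + 2 * (Q / 2 / t) := by
    rw [hQ]; ring
  linarith

end Recursion

/-! ### The mean gradient of a stochastic optimization problem -/

lemma measurable_euclideanSpace {α : Type*} {mα : MeasurableSpace α} {p : ℕ}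
    {g : α → EuclideanSpace ℝ (Fin p)} (h : ∀ k, Measurable fun x => g x k) : Measurable g :=
  (WithLp.measurable_toLp 2 (Fin p → ℝ)).comp (measurable_pi_iff.2 h)

lemma integrable_inner_of_memLp {α E : Type*} {mα : MeasurableSpace α} {ν : Measure α}
    [NormedAddCommGroup E] [InnerProductSpace ℝ E] {f g : α → E}
    (hf : MemLp f 2 ν) (hg : MemLp g 2 ν) : Integrable (fun x => inner ℝ (f x) (g x)) ν := by
  have h1 := (memLp_two_iff_integrable_sq_norm hf.1).1 hf
  have h2 := (memLp_two_iff_integrable_sq_norm hg.1).1 hg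
  refine (h1.add h2).mono' (hf.1.inner hg.1) (ae_of_all _ fun x => ?_)
  simp only [Pi.add_apply]
  have := norm_inner_le_norm (𝕜 := ℝ) (f x) (g x)
  nlinarith [sq_nonneg (‖f x‖ - ‖g x‖), sq_nonneg (‖f x‖ + ‖g x‖)]

section Problem

variable {p : ℕ} {Ξ : Type*} [MeasurableSpace Ξ] {D : Measure Ξ}
  {f : EuclideanSpace ℝ (Fin p) → Ξ → ℝ} {L μ N : ℝ} {wstar : EuclideanSpace ℝ (Fin p)}

/-- The gradient `∇f(w; x)` of the loss. -/
def lossGrad (f : EuclideanSpace ℝ (Fin p) → Ξ → ℝ) (w : EuclideanSpace ℝ (Fin p)) (x : Ξ) :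
    EuclideanSpace ℝ (Fin p) := gradient (fun v => f v x) w

/-- The expectation `𝔼 ∇f(w; ξ)`. It replaces the gradient of the objective, so that no
differentiation under the integral sign is needed. -/
def meanGrad (D : Measure Ξ) (f : EuclideanSpace ℝ (Fin p) → Ξ → ℝ)
    (w : EuclideanSpace ℝ (Fin p)) : EuclideanSpace ℝ (Fin p) := ∫ x, lossGrad f w x ∂D

/-- The coordinates of the gradient are limits of difference quotients, which are measurable. -/
lemma IsProblem.measurable_lossGrad (h : IsProblem D f L μ N wstar)
    (w : EuclideanSpace ℝ (Fin p)) : Measurable (lossGrad f w) := by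
  refine measurable_euclideanSpace fun k => ?_
  refine measurable_of_tendsto_metrizable (f := fun (n : ℕ) x => ((n : ℝ) + 1) *
    (f (w + ((n : ℝ) + 1)⁻¹ • EuclideanSpace.single k (1 : ℝ)) x - f w x)) (fun n => ?_)
    (tendsto_pi_nhds.2 fun x => ?_)
  · exact ((h.measurable _).sub (h.measurable w)).const_mul _
  · have hd := (h.differentiable x w).hasFDerivAt
    have hc : Tendsto (fun n : ℕ => ‖(n : ℝ) + 1‖) atTop atTop :=
      tendsto_norm_atTop_atTop.comp
        (tendsto_atTop_add_const_right _ _ tendsto_natCast_atTop_atTop)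
    have := hd.lim (EuclideanSpace.single k (1 : ℝ)) hc
    rw [← inner_gradient_left, EuclideanSpace.inner_single_right] at this
    simpa [lossGrad] using this

lemma IsProblem.lipschitz_lossGrad (h : IsProblem D f L μ N wstar)
    (w w' : EuclideanSpace ℝ (Fin p)) (x : Ξ) :
    ‖lossGrad f w x - lossGrad f w' x‖ ≤ L * ‖w - w'‖ := h.smooth x w w'

lemma IsProblem.norm_lossGrad_le (h : IsProblem D f L μ N wstar)
    (w : EuclideanSpace ℝ (Fin p)) (x : Ξ) :
    ‖lossGrad f w x‖ ≤ L * ‖w - wstar‖ + ‖lossGrad f wstar x‖ := by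
  have h1 := h.lipschitz_lossGrad w wstar x
  have h2 := norm_add_le (lossGrad f w x - lossGrad f wstar x) (lossGrad f wstar x)
  rw [sub_add_cancel] at h2
  linarith

lemma IsProblem.continuous_lossGrad (h : IsProblem D f L μ N wstar) (hL : 0 < L) (x : Ξ) :
    Continuous fun w => lossGrad f w x :=
  (LipschitzWith.of_dist_le_mul (K := ⟨L, hL.le⟩) fun w w' => by
    rw [dist_eq_norm, dist_eq_norm]; exact h.lipschitz_lossGrad w w' x).continuous

lemma IsProblem.measurable_uncurry_lossGrad (h : IsProblem D f L μ N wstar) (hL : 0 < L) :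
    Measurable (Function.uncurry (lossGrad f)) :=
  measurable_uncurry_of_continuous_of_measurable (h.continuous_lossGrad hL) h.measurable_lossGrad

lemma IsProblem.memLp_lossGrad_wstar (h : IsProblem D f L μ N wstar) :
    MemLp (lossGrad f wstar) 2 D :=
  (memLp_two_iff_integrable_sq_norm (h.measurable_lossGrad wstar).aestronglyMeasurable).2
    h.noise_finite

lemma IsProblem.integrable_lossGrad (h : IsProblem D f L μ N wstar)
    (w : EuclideanSpace ℝ (Fin p)) : Integrable (lossGrad f w) D := by
  have := h.prob
  refine ((integrable_const (L * ‖w - wstar‖)).add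
    (h.memLp_lossGrad_wstar.integrable one_le_two).norm).mono'
    (h.measurable_lossGrad w).aestronglyMeasurable (ae_of_all _ fun x => ?_)
  exact h.norm_lossGrad_le w x

lemma IsProblem.lipschitz_meanGrad (h : IsProblem D f L μ N wstar)
    (w w' : EuclideanSpace ℝ (Fin p)) :
    ‖meanGrad D f w - meanGrad D f w'‖ ≤ L * ‖w - w'‖ := by
  have := h.prob
  rw [meanGrad, meanGrad, ← integral_sub (h.integrable_lossGrad w) (h.integrable_lossGrad w')]
  simpa using norm_integral_le_of_norm_le_const (μ := D)
    (ae_of_all _ fun x => h.lipschitz_lossGrad w w' x)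

lemma IsProblem.inner_meanGrad_le (h : IsProblem D f L μ N wstar)
    (w w' : EuclideanSpace ℝ (Fin p)) :
    inner ℝ (meanGrad D f w') (w - w') ≤ objective D f w - objective D f w' := by
  have hint := (h.integrable_lossGrad w').const_inner (𝕜 := ℝ) (w - w')
  rw [objective, objective, ← integral_sub (h.integrable w) (h.integrable w'), meanGrad,
    real_inner_comm, ← integral_inner (h.integrable_lossGrad w')]
  refine integral_mono hint ((h.integrable w).sub (h.integrable w')) fun x => ?_
  have := h.convex x w w'
  rw [real_inner_comm] at this
  exact this

lemma IsProblem.le_objective_sub (h : IsProblem D f L μ N wstar)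
    (w : EuclideanSpace ℝ (Fin p)) :
    μ / 2 * ‖w - wstar‖ ^ 2 ≤ objective D f w - objective D f wstar := by
  have h1 : IsLocalMin (objective D f) wstar := Eventually.of_forall h.minimizer
  have h2 : gradient (objective D f) wstar = 0 := by
    rw [gradient, h1.fderiv_eq_zero, map_zero]
  have h3 := h.stronglyConvex w wstar
  rw [h2, inner_zero_left] at h3
  linarith

lemma IsProblem.le_inner_meanGrad (h : IsProblem D f L μ N wstar)
    (w : EuclideanSpace ℝ (Fin p)) :
    μ / 2 * ‖w - wstar‖ ^ 2 ≤ inner ℝ (meanGrad D f w) (w - wstar) := by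
  have h1 := h.inner_meanGrad_le wstar w
  have h2 := h.le_objective_sub w
  rw [← neg_sub w wstar, inner_neg_right] at h1
  linarith

/-- The mean gradient vanishes at the minimizer: otherwise a small step against it would decrease
the objective. -/
lemma IsProblem.meanGrad_wstar (h : IsProblem D f L μ N wstar) (hL : 0 < L) (hμ : 0 < μ) :
    meanGrad D f wstar = 0 := by
  set v := meanGrad D f wstar with hv
  by_contra hne
  have hv0 : 0 < ‖v‖ := norm_pos_iff.2 hne
  set ε := 1 / (2 * L) with hε
  have hε0 : 0 < ε := by positivity
  have h1 := h.le_inner_meanGrad (wstar - ε • v)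
  have h2 := h.lipschitz_meanGrad (wstar - ε • v) wstar
  have e : wstar - ε • v - wstar = -(ε • v) := by abel
  rw [e, norm_neg, norm_smul, Real.norm_of_nonneg hε0.le] at h1 h2
  rw [← hv] at h2
  rw [inner_neg_right, inner_smul_right] at h1
  set u := meanGrad D f (wstar - ε • v)
  have h3 : inner ℝ u v = ‖v‖ ^ 2 + inner ℝ (u - v) v := by
    rw [inner_sub_left, real_inner_self_eq_norm_sq]; ring
  have h4 : -(‖u - v‖ * ‖v‖) ≤ inner ℝ (u - v) v :=
    (abs_le.1 (abs_real_inner_le_norm (u - v) v)).1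
  have h5 : L * (ε * ‖v‖) = ‖v‖ / 2 := by rw [hε]; field_simp
  have h6 : ‖u - v‖ * ‖v‖ ≤ ‖v‖ / 2 * ‖v‖ := by
    rw [← h5]; gcongr
  have h7 : 0 < inner ℝ u v := by nlinarith
  have h8 : 0 ≤ μ / 2 * (ε * ‖v‖) ^ 2 := by positivity
  nlinarith [mul_pos hε0 h7]

/-- Strong monotonicity of the mean gradient, evaluated at `u`, seen from another point `v`. -/
lemma IsProblem.le_inner_meanGrad_sub (h : IsProblem D f L μ N wstar) (hL : 0 < L) (hμ : 0 < μ)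
    (u v : EuclideanSpace ℝ (Fin p)) :
    μ / 4 * ‖u - wstar‖ ^ 2 - L ^ 2 / μ * ‖v - u‖ ^ 2
      ≤ inner ℝ (meanGrad D f u) (v - wstar) := by
  have h1 := h.le_inner_meanGrad u
  have h2 : ‖meanGrad D f u‖ ≤ L * ‖u - wstar‖ := by
    simpa [h.meanGrad_wstar hL hμ] using h.lipschitz_meanGrad u wstar
  have h3 : -(‖meanGrad D f u‖ * ‖v - u‖) ≤ inner ℝ (meanGrad D f u) (v - u) :=
    (abs_le.1 (abs_real_inner_le_norm _ _)).1
  have h4 : ‖meanGrad D f u‖ * ‖v - u‖ ≤ L * ‖u - wstar‖ * ‖v - u‖ := by gcongr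
  have h5 : L * ‖u - wstar‖ * ‖v - u‖ ≤ μ / 4 * ‖u - wstar‖ ^ 2 + L ^ 2 / μ * ‖v - u‖ ^ 2 := by
    have : 0 ≤ (μ / 2 * ‖u - wstar‖ - L * ‖v - u‖) ^ 2 / μ := by positivity
    have e : (μ / 2 * ‖u - wstar‖ - L * ‖v - u‖) ^ 2 / μ = μ / 4 * ‖u - wstar‖ ^ 2
        + L ^ 2 / μ * ‖v - u‖ ^ 2 - L * ‖u - wstar‖ * ‖v - u‖ := by
      field_simp
      ring
    linarith
  have e : v - wstar = (v - u) + (u - wstar) := by abel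
  rw [e, inner_add_right]
  linarith

end Problem

/-! ### Moments of a run -/

section Run

variable {p : ℕ} {Ξ Ω : Type*} [MeasurableSpace Ξ] {mΩ : MeasurableSpace Ω}
  {P : Measure Ω} {D : Measure Ξ} {f : EuclideanSpace ℝ (Fin p) → Ξ → ℝ}
  {L μ N : ℝ} {wstar w0 : EuclideanSpace ℝ (Fin p)} {η : ℕ → ℝ} {τ : ℝ → ℝ}
  {ℱ : Filtration ℕ mΩ} {ξ : ℕ → Ω → Ξ} {U : ℕ → Fin p → Ω → Finset ℕ}
  {w what : ℕ → Ω → EuclideanSpace ℝ (Fin p)}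

lemma IsRun.measurable_sample (hr : IsRun P D f w0 η τ ℱ ξ U w what) (t : ℕ) :
    Measurable (ξ t) := (hr.sample_measurable t).mono (ℱ.le _) le_rfl

lemma IsRun.read_subset_range (hr : IsRun P D f w0 η τ ℱ ξ U w what) (t : ℕ) (k : Fin p) (ω : Ω) :
    U t k ω ⊆ Finset.range t := fun _ hj => Finset.mem_range.2 (hr.read_previous t k ω _ hj)

lemma IsRun.eq_sub_sum (hr : IsRun P D f w0 η τ ℱ ξ U w what) (t : ℕ) (ω : Ω) :
    w t ω = w0 - ∑ j ∈ Finset.range t, η j • lossGrad f (what j ω) (ξ j ω) := by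
  induction t with
  | zero => simp [hr.init]
  | succ t ih => rw [hr.step, ih, Finset.sum_range_succ, lossGrad, sub_sub]

/-- Both the iterate and the read vector of iteration `t` belong to the history before it. -/
lemma IsRun.measurable_iterates (hf : IsProblem D f L μ N wstar) (hL : 0 < L)
    (hr : IsRun P D f w0 η τ ℱ ξ U w what) (t : ℕ) :
    Measurable[ℱ t] (w t) ∧ Measurable[ℱ t] (what t) := by
  induction t using Nat.strong_induction_on with
  | _ t ih =>
    have hg : ∀ j < t, Measurable[ℱ t] fun ω => lossGrad f (what j ω) (ξ j ω) := fun j hj =>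
      (hf.measurable_uncurry_lossGrad hL).comp
        (((ih j hj).2.mono (ℱ.mono hj.le) le_rfl).prodMk
          ((hr.sample_measurable j).mono (ℱ.mono hj) le_rfl))
    constructor
    · rw [funext (hr.eq_sub_sum t)]
      exact (Finset.measurable_fun_sum (m := ℱ t) _ fun j hj =>
        (hg j (Finset.mem_range.1 hj)).const_smul (η j)).const_sub w0
    · refine measurable_euclideanSpace fun k => ?_
      have e : (fun ω => what t ω k) = fun ω => w0 k - ∑ j ∈ Finset.range t,
          Set.indicator {ω | j ∈ U t k ω} (fun ω => η j * lossGrad f (what j ω) (ξ j ω) k) ω := by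
        funext ω
        rw [hr.read_eq, ← Finset.sum_subset (hr.read_subset_range t k ω)]
        · congr 1
          refine Finset.sum_congr rfl fun j hj => ?_
          exact (Set.indicator_of_mem (s := {ω | j ∈ U t k ω}) hj
            fun ω => η j * lossGrad f (what j ω) (ξ j ω) k).symm
        · intro j _ hj
          exact Set.indicator_of_notMem (s := {ω | j ∈ U t k ω}) hj _
      rw [e]
      refine (Finset.measurable_fun_sum (m := ℱ t) _ fun j hj => ?_).const_sub _
      refine Measurable.indicator ?_ (hr.read_measurable t k j)
      have hk : Measurable fun x : EuclideanSpace ℝ (Fin p) => x k := by fun_prop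
      exact (hk.comp (hg j (Finset.mem_range.1 hj))).const_mul _

/-- The read vector misses at most the `⌈τ t⌉` most recent updates, in each coordinate. -/
lemma IsRun.norm_sub_sq_le (hr : IsRun P D f w0 η τ ℱ ξ U w what) (t : ℕ) (ω : Ω) :
    ‖w t ω - what t ω‖ ^ 2 ≤ (⌈τ t⌉₊ : ℝ) * ∑ j ∈ Finset.Ico (t - ⌈τ t⌉₊) t,
      η j ^ 2 * ‖lossGrad f (what j ω) (ξ j ω)‖ ^ 2 := by
  set n := ⌈τ t⌉₊ with hn
  have hcard : ((Finset.Ico (t - n) t).card : ℝ) ≤ n := by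
    rw [Nat.card_Ico]
    exact_mod_cast (by omega : t - (t - n) ≤ n)
  have hcoord : ∀ k, ((w t ω - what t ω) k) ^ 2 ≤ (n : ℝ) * ∑ j ∈ Finset.Ico (t - n) t,
      (η j * lossGrad f (what j ω) (ξ j ω) k) ^ 2 := by
    intro k
    have hmiss : Finset.range t \ U t k ω ⊆ Finset.Ico (t - n) t := by
      intro j hj
      rw [Finset.mem_sdiff, Finset.mem_range] at hj
      rw [Finset.mem_Ico]
      refine ⟨?_, hj.1⟩
      by_contra hlt
      refine hj.2 (hr.read_delay t k ω j ?_)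
      have h1 : τ t ≤ n := Nat.le_ceil _
      have h2 : (j : ℝ) + 1 + n ≤ t := by exact_mod_cast (by omega : j + 1 + n ≤ t)
      linarith
    have e : (w t ω - what t ω) k
        = -∑ j ∈ Finset.range t \ U t k ω, η j * lossGrad f (what j ω) (ξ j ω) k := by
      have h1 : w t ω k
          = w0 k - ∑ j ∈ Finset.range t, η j * lossGrad f (what j ω) (ξ j ω) k := by
        rw [hr.eq_sub_sum]
        simp
      have h2 := Finset.sum_sdiff (hr.read_subset_range t k ω)
        (f := fun j => η j * lossGrad f (what j ω) (ξ j ω) k)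
      have h3 := hr.read_eq t ω k
      change what t ω k = w0 k - ∑ j ∈ U t k ω, η j * lossGrad f (what j ω) (ξ j ω) k at h3
      rw [PiLp.sub_apply, h1, h3, ← h2]
      ring
    rw [e, neg_sq]
    refine sq_sum_le_card_mul_sum_sq.trans ?_
    have hs : 0 ≤ ∑ j ∈ Finset.Ico (t - n) t, (η j * lossGrad f (what j ω) (ξ j ω) k) ^ 2 :=
      Finset.sum_nonneg fun _ _ => sq_nonneg _
    refine mul_le_mul ?_ (Finset.sum_le_sum_of_subset_of_nonneg hmiss fun _ _ _ => sq_nonneg _)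
      (Finset.sum_nonneg fun _ _ => sq_nonneg _) (by positivity)
    refine le_trans ?_ hcard
    exact_mod_cast Finset.card_le_card hmiss
  rw [EuclideanSpace.real_norm_sq_eq]
  refine (Finset.sum_le_sum fun k _ => hcoord k).trans (le_of_eq ?_)
  rw [← Finset.mul_sum, Finset.sum_comm]
  congr 1
  refine Finset.sum_congr rfl fun j _ => ?_
  rw [EuclideanSpace.real_norm_sq_eq, Finset.mul_sum]
  exact Finset.sum_congr rfl fun k _ => mul_pow _ _ _

lemma IsRun.memLp_noise (hf : IsProblem D f L μ N wstar)
    (hr : IsRun P D f w0 η τ ℱ ξ U w what) (t : ℕ) :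
    MemLp (fun ω => lossGrad f wstar (ξ t ω)) 2 P := by
  have h := hf.memLp_lossGrad_wstar
  rw [← hr.sample_law t] at h
  exact h.comp_of_map (hr.measurable_sample t).aemeasurable

lemma IsRun.measurable_grad (hf : IsProblem D f L μ N wstar) (hL : 0 < L)
    (hr : IsRun P D f w0 η τ ℱ ξ U w what) (t : ℕ) :
    Measurable fun ω => lossGrad f (what t ω) (ξ t ω) :=
  (hf.measurable_uncurry_lossGrad hL).comp
    (((hr.measurable_iterates hf hL t).2.mono (ℱ.le t) le_rfl).prodMk (hr.measurable_sample t))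

lemma IsRun.memLp (hf : IsProblem D f L μ N wstar) (hL : 0 < L)
    (hr : IsRun P D f w0 η τ ℱ ξ U w what) (t : ℕ) :
    MemLp (fun ω => w t ω - wstar) 2 P ∧ MemLp (fun ω => w t ω - what t ω) 2 P ∧
      MemLp (fun ω => lossGrad f (what t ω) (ξ t ω)) 2 P := by
  have := hr.prob
  induction t using Nat.strong_induction_on with
  | _ t ih =>
    have hw : Measurable (w t) := (hr.measurable_iterates hf hL t).1.mono (ℱ.le t) le_rfl
    have hwhat : Measurable (what t) := (hr.measurable_iterates hf hL t).2.mono (ℱ.le t) le_rfl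
    have h1 : MemLp (fun ω => w t ω - wstar) 2 P := by
      have h : MemLp (fun ω => (w0 - wstar) - ∑ j ∈ Finset.range t,
          η j • lossGrad f (what j ω) (ξ j ω)) 2 P :=
        (memLp_const _).sub (memLp_finsetSum _ fun j hj =>
          (ih j (Finset.mem_range.1 hj)).2.2.const_smul (η j))
      refine h.congr_norm (hw.sub_const _).aestronglyMeasurable (ae_of_all _ fun ω => ?_)
      rw [hr.eq_sub_sum]
      congr 1
      abel
    have h2 : MemLp (fun ω => w t ω - what t ω) 2 P := by
      refine (memLp_two_iff_integrable_sq_norm (hw.sub hwhat).aestronglyMeasurable).2 ?_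
      refine Integrable.mono' (((integrable_finsetSum (Finset.Ico (t - ⌈τ t⌉₊) t) fun j hj =>
        ((memLp_two_iff_integrable_sq_norm (ih j (Finset.mem_Ico.1 hj).2).2.2.1).1
          (ih j (Finset.mem_Ico.1 hj).2).2.2).const_mul (η j ^ 2))).const_mul (⌈τ t⌉₊ : ℝ))
        ((hw.sub hwhat).norm.pow_const 2).aestronglyMeasurable (ae_of_all _ fun ω => ?_)
      rw [Real.norm_of_nonneg (by positivity)]
      exact hr.norm_sub_sq_le t ω
    refine ⟨h1, h2, ?_⟩
    have h3 : MemLp (fun ω => what t ω - wstar) 2 P :=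
      (h1.sub h2).congr_norm (hwhat.sub_const _).aestronglyMeasurable (ae_of_all _ fun ω => by simp)
    refine ((h3.norm.const_mul L).add (hr.memLp_noise hf t).norm).mono'
      (hr.measurable_grad hf hL t).aestronglyMeasurable (ae_of_all _ fun ω => ?_)
    exact hf.norm_lossGrad_le _ _

lemma IsRun.memLp_read (hf : IsProblem D f L μ N wstar) (hL : 0 < L)
    (hr : IsRun P D f w0 η τ ℱ ξ U w what) (t : ℕ) :
    MemLp (fun ω => what t ω - wstar) 2 P := by
  obtain ⟨h1, h2, -⟩ := hr.memLp hf hL t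
  have hwhat : Measurable (what t) := (hr.measurable_iterates hf hL t).2.mono (ℱ.le t) le_rfl
  exact (h1.sub h2).congr_norm (hwhat.sub_const _).aestronglyMeasurable
    (ae_of_all _ fun ω => by simp)

/-- Given the history, the sampled gradient has the mean gradient as its expectation: the sample
is independent of the iterate and of the read vector. -/
lemma IsRun.le_integral_inner (hf : IsProblem D f L μ N wstar) (hL : 0 < L) (hμ : 0 < μ)
    (hr : IsRun P D f w0 η τ ℱ ξ U w what) (t : ℕ) :
    μ / 4 * ∫ ω, ‖what t ω - wstar‖ ^ 2 ∂P - L ^ 2 / μ * ∫ ω, ‖w t ω - what t ω‖ ^ 2 ∂P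
      ≤ ∫ ω, inner ℝ (lossGrad f (what t ω) (ξ t ω)) (w t ω - wstar) ∂P := by
  have hP := hr.prob
  have hD := hf.prob
  obtain ⟨h1, h2, h3⟩ := hr.memLp hf hL t
  have h4 := hr.memLp_read hf hL t
  have hX : Measurable[ℱ t] fun ω => (what t ω, w t ω) :=
    (hr.measurable_iterates hf hL t).2.prodMk (hr.measurable_iterates hf hL t).1
  have hX' : Measurable fun ω => (what t ω, w t ω) := hX.mono (ℱ.le t) le_rfl
  have hind : IndepFun (fun ω => (what t ω, w t ω)) (ξ t) P := by
    rw [IndepFun_iff_Indep]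
    exact indep_of_indep_of_le_left (hr.sample_indep t).symm hX.comap_le
  have hlaw := hind.map_prod_eq_prod_map_map hX'.aemeasurable (hr.measurable_sample t).aemeasurable
  rw [hr.sample_law t] at hlaw
  set ν := P.map fun ω => (what t ω, w t ω) with hν
  have hpair : Measurable fun ω => ((what t ω, w t ω), ξ t ω) := hX'.prodMk (hr.measurable_sample t)
  have hΨ : Measurable fun z : (EuclideanSpace ℝ (Fin p) × EuclideanSpace ℝ (Fin p)) × Ξ =>
      inner ℝ (lossGrad f z.1.1 z.2) (z.1.2 - wstar) :=
    ((hf.measurable_uncurry_lossGrad hL).comp (measurable_fst.fst.prodMk measurable_snd)).inner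
      (measurable_fst.snd.sub_const _)
  have hint : Integrable (fun z : (EuclideanSpace ℝ (Fin p) × EuclideanSpace ℝ (Fin p)) × Ξ =>
      inner ℝ (lossGrad f z.1.1 z.2) (z.1.2 - wstar)) (ν.prod D) := by
    rw [← hlaw, integrable_map_measure hΨ.aestronglyMeasurable hpair.aemeasurable]
    exact integrable_inner_of_memLp h3 h1
  have hinner : ∀ z : EuclideanSpace ℝ (Fin p) × EuclideanSpace ℝ (Fin p),
      ∫ x, inner ℝ (lossGrad f z.1 x) (z.2 - wstar) ∂D
        = inner ℝ (meanGrad D f z.1) (z.2 - wstar) := by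
    intro z
    rw [meanGrad, real_inner_comm, ← integral_inner (hf.integrable_lossGrad z.1)]
    exact integral_congr_ae (ae_of_all _ fun x => real_inner_comm _ _)
  have hint2 : Integrable (fun z : EuclideanSpace ℝ (Fin p) × EuclideanSpace ℝ (Fin p) =>
      inner ℝ (meanGrad D f z.1) (z.2 - wstar)) ν := by
    have := hint.integral_prod_left
    simpa only [hinner] using this
  have e1 : ∫ ω, inner ℝ (lossGrad f (what t ω) (ξ t ω)) (w t ω - wstar) ∂P
      = ∫ ω, inner ℝ (meanGrad D f (what t ω)) (w t ω - wstar) ∂P := by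
    have h := integral_map (μ := P) hpair.aemeasurable hΨ.aestronglyMeasurable
    rw [hlaw, integral_prod _ hint] at h
    simp only [hinner] at h
    rw [← h, integral_map hX'.aemeasurable hint2.aestronglyMeasurable]
  rw [e1]
  have i1 := (memLp_two_iff_integrable_sq_norm h4.1).1 h4
  have i2 := (memLp_two_iff_integrable_sq_norm h2.1).1 h2
  rw [← integral_const_mul, ← integral_const_mul,
    ← integral_sub (i1.const_mul _) (i2.const_mul _)]
  refine integral_mono ((i1.const_mul _).sub (i2.const_mul _))
    ((integrable_map_measure hint2.aestronglyMeasurable hX'.aemeasurable).1 hint2) fun ω => ?_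
  exact hf.le_inner_meanGrad_sub hL hμ _ _

lemma norm_sq_le_two_mul {E : Type*} [SeminormedAddCommGroup E] (x y : E) :
    ‖x‖ ^ 2 ≤ 2 * ‖y‖ ^ 2 + 2 * ‖x - y‖ ^ 2 := by
  have h : ‖x‖ ≤ ‖y‖ + ‖x - y‖ := by simpa using norm_add_le y (x - y)
  nlinarith [sq_nonneg (‖y‖ - ‖x - y‖), norm_nonneg x]

/-- The second moments of a run solve the scalar recursion with delays. -/
theorem IsRun.delayedRecursion {R : ℝ} (hf : IsProblem D f L μ N wstar) (hL : 0 < L) (hμ : 0 < μ)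
    (hη : ∀ t, 0 < η t) (hR : ‖w0 - wstar‖ ≤ R) (hr : IsRun P D f w0 η τ ℱ ξ U w what) :
    DelayedRecursion η (fun t => ⌈τ t⌉₊) L μ N R (fun t => ∫ ω, ‖w t ω - wstar‖ ^ 2 ∂P)
      (fun t => ∫ ω, ‖w t ω - what t ω‖ ^ 2 ∂P)
      (fun t => ∫ ω, ‖lossGrad f (what t ω) (ξ t ω)‖ ^ 2 ∂P) := by
  have hP := hr.prob
  have i1 : ∀ t, Integrable (fun ω => ‖w t ω - wstar‖ ^ 2) P := fun t =>
    (memLp_two_iff_integrable_sq_norm (hr.memLp hf hL t).1.1).1 (hr.memLp hf hL t).1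
  have i2 : ∀ t, Integrable (fun ω => ‖w t ω - what t ω‖ ^ 2) P := fun t =>
    (memLp_two_iff_integrable_sq_norm (hr.memLp hf hL t).2.1.1).1 (hr.memLp hf hL t).2.1
  have i3 : ∀ t, Integrable (fun ω => ‖lossGrad f (what t ω) (ξ t ω)‖ ^ 2) P := fun t =>
    (memLp_two_iff_integrable_sq_norm (hr.memLp hf hL t).2.2.1).1 (hr.memLp hf hL t).2.2
  have i4 : ∀ t, Integrable (fun ω => ‖what t ω - wstar‖ ^ 2) P := fun t =>
    (memLp_two_iff_integrable_sq_norm (hr.memLp_read hf hL t).1).1 (hr.memLp_read hf hL t)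
  have i5 : ∀ t, Integrable (fun ω => ‖lossGrad f wstar (ξ t ω)‖ ^ 2) P := fun t =>
    (memLp_two_iff_integrable_sq_norm (hr.memLp_noise hf t).1).1 (hr.memLp_noise hf t)
  refine ⟨fun t => integral_nonneg fun _ => by positivity,
    fun t => integral_nonneg fun _ => by positivity,
    fun t => integral_nonneg fun _ => by positivity, ?_, fun t => ?_, fun t => ?_, fun t => ?_⟩
  · simp only [hr.init]
    simpa using pow_le_pow_left₀ (norm_nonneg _) hR 2
  · have hpt : ∀ ω, ‖w (t + 1) ω - wstar‖ ^ 2 = ‖w t ω - wstar‖ ^ 2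
        - 2 * η t * inner ℝ (lossGrad f (what t ω) (ξ t ω)) (w t ω - wstar)
        + η t ^ 2 * ‖lossGrad f (what t ω) (ξ t ω)‖ ^ 2 := by
      intro ω
      have e : w (t + 1) ω - wstar
          = (w t ω - wstar) - η t • lossGrad f (what t ω) (ξ t ω) := by
        rw [hr.step, lossGrad]; abel
      rw [e, norm_sub_sq_real, inner_smul_right, norm_smul, real_inner_comm, mul_pow,
        Real.norm_eq_abs, sq_abs]
      ring
    have hii := integrable_inner_of_memLp (hr.memLp hf hL t).2.2 (hr.memLp hf hL t).1
    simp only [hpt]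
    have hdiff : Integrable (fun ω => ‖w t ω - wstar‖ ^ 2
        - 2 * η t * inner ℝ (lossGrad f (what t ω) (ξ t ω)) (w t ω - wstar)) P :=
      (i1 t).sub (hii.const_mul _)
    rw [integral_add hdiff ((i3 t).const_mul _),
      integral_sub (i1 t) (hii.const_mul _), integral_const_mul, integral_const_mul]
    have h1 := hr.le_integral_inner hf hL hμ t
    have h2 : ∫ ω, ‖w t ω - wstar‖ ^ 2 ∂P
        ≤ 2 * ∫ ω, ‖what t ω - wstar‖ ^ 2 ∂P + 2 * ∫ ω, ‖w t ω - what t ω‖ ^ 2 ∂P := by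
      rw [← integral_const_mul, ← integral_const_mul,
        ← integral_add ((i4 t).const_mul _) ((i2 t).const_mul _)]
      refine integral_mono (i1 t) (((i4 t).const_mul _).add ((i2 t).const_mul _)) fun ω => ?_
      simpa using norm_sq_le_two_mul (w t ω - wstar) (what t ω - wstar)
    set A := ∫ ω, ‖w t ω - wstar‖ ^ 2 ∂P
    set H := ∫ ω, ‖what t ω - wstar‖ ^ 2 ∂P
    set B := ∫ ω, ‖w t ω - what t ω‖ ^ 2 ∂P
    set I := ∫ ω, inner ℝ (lossGrad f (what t ω) (ξ t ω)) (w t ω - wstar) ∂P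
    have h3 : μ / 8 * A - (μ / 4 + L ^ 2 / μ) * B ≤ I := by nlinarith
    have h4 := mul_le_mul_of_nonneg_left h3 (show 0 ≤ 2 * η t by linarith [hη t])
    have e : 2 * η t * (μ / 8 * A - (μ / 4 + L ^ 2 / μ) * B)
        = μ * η t / 4 * A - (μ / 2 + 2 * L ^ 2 / μ) * η t * B := by ring
    linarith
  · have hN : N = 2 * ∫ ω, ‖lossGrad f wstar (ξ t ω)‖ ^ 2 ∂P := by
      have h := integral_map (μ := P) (hr.measurable_sample t).aemeasurable
        (f := fun x => ‖lossGrad f wstar x‖ ^ 2)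
        ((hf.measurable_lossGrad wstar).norm.pow_const 2).aestronglyMeasurable
      rw [hr.sample_law t] at h
      rw [← h, hf.noise_eq]
      rfl
    have hsum : Integrable (fun ω =>
        4 * L ^ 2 * (‖w t ω - wstar‖ ^ 2 + ‖w t ω - what t ω‖ ^ 2)) P :=
      ((i1 t).add (i2 t)).const_mul _
    rw [hN, ← integral_add (i1 t) (i2 t), ← integral_const_mul, ← integral_const_mul,
      ← integral_add hsum ((i5 t).const_mul _)]
    refine integral_mono (i3 t) (hsum.add ((i5 t).const_mul _)) fun ω => ?_
    have h1 := norm_sq_le_two_mul (lossGrad f (what t ω) (ξ t ω)) (lossGrad f wstar (ξ t ω))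
    have h2 := pow_le_pow_left₀ (norm_nonneg _)
      (hf.lipschitz_lossGrad (what t ω) wstar (ξ t ω)) 2
    have h3 := norm_sq_le_two_mul (what t ω - wstar) (w t ω - wstar)
    rw [sub_sub_sub_cancel_right, norm_sub_rev (what t ω) (w t ω)] at h3
    rw [mul_pow] at h2
    have h4 := mul_le_mul_of_nonneg_left h3 (sq_nonneg L)
    change ‖lossGrad f (what t ω) (ξ t ω)‖ ^ 2 ≤ 4 * L ^ 2 * (‖w t ω - wstar‖ ^ 2
      + ‖w t ω - what t ω‖ ^ 2) + 2 * ‖lossGrad f wstar (ξ t ω)‖ ^ 2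
    linarith
  · have hsum : Integrable (fun ω => (⌈τ t⌉₊ : ℝ) * ∑ j ∈ Finset.Ico (t - ⌈τ t⌉₊) t,
        η j ^ 2 * ‖lossGrad f (what j ω) (ξ j ω)‖ ^ 2) P :=
      (integrable_finsetSum _ fun j _ => (i3 j).const_mul _).const_mul _
    refine (integral_mono (i2 t) hsum fun ω => hr.norm_sub_sq_le t ω).trans (le_of_eq ?_)
    rw [integral_const_mul, integral_finsetSum _ fun j _ => (i3 j).const_mul _]
    simp only [integral_const_mul]

end Run

/-! ### A quadratic problem with two-point noise -/

/-- The value `1` or `-1` of a fair coin. -/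
def coinSign (x : Bool) : ℝ := if x then 1 else -1

/-- The law of a fair coin. -/
def coinLaw : Measure Bool := (PMF.uniformOfFintype Bool).toMeasure

/-- The loss `μ / 2 ‖w‖² ± ⟪v, w⟫`. -/
def coinLoss {p : ℕ} (μ : ℝ) (v w : EuclideanSpace ℝ (Fin p)) (x : Bool) : ℝ :=
  μ / 2 * ‖w‖ ^ 2 + coinSign x * inner ℝ v w

instance : IsProbabilityMeasure coinLaw := by unfold coinLaw; infer_instance

lemma integral_coinLaw (g : Bool → ℝ) : ∫ x, g x ∂coinLaw = (g true + g false) / 2 := by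
  rw [coinLaw, PMF.integral_eq_sum]
  simp
  ring

lemma hasGradientAt_quadratic {p : ℕ} (μ c : ℝ) (v w : EuclideanSpace ℝ (Fin p)) :
    HasGradientAt (fun w => μ / 2 * ‖w‖ ^ 2 + c * inner ℝ v w) (μ • w + c • v) w := by
  rw [hasGradientAt_iff_hasFDerivAt]
  have h1 := ((hasStrictFDerivAt_norm_sq w).hasFDerivAt.const_mul (μ / 2)).add
    ((innerSL ℝ v).hasFDerivAt (x := w) |>.const_mul c)
  refine h1.congr_fderiv ?_
  ext u
  simp
  ring

section

variable {p : ℕ} (μ : ℝ) (v : EuclideanSpace ℝ (Fin p))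

lemma lossGrad_coinLoss (w : EuclideanSpace ℝ (Fin p)) (x : Bool) :
    lossGrad (coinLoss μ v) w x = μ • w + coinSign x • v :=
  (hasGradientAt_quadratic μ (coinSign x) v w).gradient

lemma objective_coinLoss : objective coinLaw (coinLoss μ v) =
    fun w => μ / 2 * ‖w‖ ^ 2 + 0 * inner ℝ v w := by
  funext w
  rw [objective, integral_coinLaw]
  simp [coinLoss, coinSign]
  ring

lemma isProblem_coinLoss {L N : ℝ} (hμ : 0 < μ) (hL : μ ≤ L) (hv : N = 2 * ‖v‖ ^ 2) :
    IsProblem coinLaw (coinLoss μ v) L μ N 0 := by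
  -- the quadratic part of the loss is its own second-order expansion
  have hquad : ∀ w w' : EuclideanSpace ℝ (Fin p), ∀ c : ℝ,
      (μ / 2 * ‖w‖ ^ 2 + c * inner ℝ v w) - (μ / 2 * ‖w'‖ ^ 2 + c * inner ℝ v w')
        = inner ℝ (μ • w' + c • v) (w - w') + μ / 2 * ‖w - w'‖ ^ 2 := by
    intro w w' c
    rw [norm_sub_sq_real, inner_add_left, inner_smul_left, inner_smul_left, inner_sub_right,
      inner_sub_right, real_inner_self_eq_norm_sq, real_inner_comm w' w]
    simp
    ring
  refine ⟨inferInstance, fun w => .of_discrete, fun w => .of_finite,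
    fun x w => (hasGradientAt_quadratic μ (coinSign x) v w).differentiableAt, fun x w w' => ?_,
    fun x w w' => ?_, fun w w' => ?_, fun w => ?_, .of_finite, ?_⟩
  · change ‖lossGrad (coinLoss μ v) w x - lossGrad (coinLoss μ v) w' x‖ ≤ _
    rw [lossGrad_coinLoss, lossGrad_coinLoss, add_sub_add_right_eq_sub, ← smul_sub, norm_smul,
      Real.norm_of_nonneg hμ.le]
    gcongr
  · change inner ℝ (lossGrad (coinLoss μ v) w' x) (w - w') ≤ _
    rw [lossGrad_coinLoss, coinLoss, coinLoss, hquad]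
    have : 0 ≤ μ / 2 * ‖w - w'‖ ^ 2 := by positivity
    linarith
  · rw [objective_coinLoss, (hasGradientAt_quadratic μ 0 v w').gradient, hquad]
  · simp only [objective_coinLoss]
    simp
    positivity
  · change N = 2 * ∫ x, ‖lossGrad (coinLoss μ v) 0 x‖ ^ 2 ∂coinLaw
    rw [integral_coinLaw, hv]
    simp [lossGrad_coinLoss, coinSign]

end

/-! ### The lower bound -/

section Run

variable {p : ℕ} {Ω : Type*} {mΩ : MeasurableSpace Ω}
  {P : Measure Ω} {μ : ℝ} {v : EuclideanSpace ℝ (Fin p)}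
  {w0 : EuclideanSpace ℝ (Fin p)} {η : ℕ → ℝ} {τ : ℝ → ℝ}
  {ℱ : Filtration ℕ mΩ} {ξ : ℕ → Ω → Bool}
  {w what : ℕ → Ω → EuclideanSpace ℝ (Fin p)}

/-- The signs of the samples of a run are uncorrelated. -/
lemma IsRun.integral_sq_sum_coinSign {U : ℕ → Fin p → Ω → Finset ℕ}
    {f : EuclideanSpace ℝ (Fin p) → Bool → ℝ}
    (hr : IsRun P coinLaw f w0 η τ ℱ ξ U w what) (A : ℝ) (γ : ℕ → ℝ) (t : ℕ) :
    ∫ ω, (A + ∑ j ∈ Finset.range t, γ j * coinSign (ξ j ω)) ^ 2 ∂P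
      = A ^ 2 + ∑ j ∈ Finset.range t, γ j ^ 2 := by
  have hP := hr.prob
  have hs : Measurable coinSign := .of_discrete
  have hsq : ∀ x, coinSign x ^ 2 = 1 := by intro x; cases x <;> simp [coinSign]
  have hs2 : ∀ j, MemLp (fun ω => coinSign (ξ j ω)) 2 P := fun j =>
    MemLp.of_bound (hs.comp (hr.measurable_sample j)).aestronglyMeasurable 1
      (ae_of_all _ fun ω => by
        have := hsq (ξ j ω)
        rw [Real.norm_eq_abs, ← sq_le_one_iff_abs_le_one, this])
  induction t with
  | zero => simp
  | succ t ih =>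
    set Z : Ω → ℝ := fun ω => A + ∑ j ∈ Finset.range t, γ j * coinSign (ξ j ω) with hZ
    have hZ2 : MemLp Z 2 P :=
      (memLp_const A).add (memLp_finsetSum _ fun j _ => (hs2 j).const_mul (γ j))
    have hZm : Measurable[ℱ t] Z := by
      refine (Finset.measurable_fun_sum (m := ℱ t) _ fun j hj => ?_).const_add A
      exact (hs.comp ((hr.sample_measurable j).mono
        (ℱ.mono (Finset.mem_range.1 hj)) le_rfl)).const_mul _
    have hind : IndepFun Z (fun ω => coinSign (ξ t ω)) P := by
      have h : IndepFun Z (ξ t) P := by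
        rw [IndepFun_iff_Indep]
        exact indep_of_indep_of_le_left (hr.sample_indep t).symm hZm.comap_le
      exact h.comp measurable_id hs
    have hmean : ∫ ω, coinSign (ξ t ω) ∂P = 0 := by
      have h := integral_map (μ := P) (hr.measurable_sample t).aemeasurable
        (f := coinSign) hs.aestronglyMeasurable
      rw [hr.sample_law t, integral_coinLaw] at h
      rw [← h]
      simp [coinSign]
    have hcross : ∫ ω, Z ω * coinSign (ξ t ω) ∂P = 0 := by
      rw [hind.integral_fun_mul_eq_mul_integral hZ2.1 (hs2 t).1, hmean, mul_zero]
    have hpt : ∀ ω, (A + ∑ j ∈ Finset.range (t + 1), γ j * coinSign (ξ j ω)) ^ 2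
        = Z ω ^ 2 + 2 * γ t * (Z ω * coinSign (ξ t ω)) + γ t ^ 2 := by
      intro ω
      rw [Finset.sum_range_succ, ← add_assoc]
      change (Z ω + _) ^ 2 = _
      linear_combination γ t ^ 2 * hsq (ξ t ω)
    have i1 : Integrable (fun ω => Z ω ^ 2) P := hZ2.integrable_sq
    have i2 : Integrable (fun ω => 2 * γ t * (Z ω * coinSign (ξ t ω))) P :=
      (hZ2.integrable_mul (hs2 t)).const_mul _
    have i3 : Integrable (fun ω => Z ω ^ 2 + 2 * γ t * (Z ω * coinSign (ξ t ω))) P := i1.add i2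
    simp only [hpt]
    rw [integral_add i3 (integrable_const _), integral_add i1 i2, integral_const_mul, hcross, ih,
      Finset.sum_range_succ]
    simp
    ring

/-- With deterministic step sizes and read sets every iterate is an affine combination of the
starting point and of the minimizers `-(±σ / μ)` of the sampled losses: the recursion is
equivariant under translations. -/
lemma IsRun.exists_affine_combination {V : ℕ → Fin p → Finset ℕ} (hμ : 0 < μ) (k : Fin p)
    (hr : IsRun P coinLaw (coinLoss μ v) w0 η τ ℱ ξ (fun t k _ => V t k) w what) (t : ℕ) :
    ∃ β : ℕ → ℝ, ∀ ω, w t ω k = w0 k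
      + ∑ j ∈ Finset.range t, β j * (-(coinSign (ξ j ω) * v k / μ) - w0 k) := by
  have hP := hr.prob
  set y : ℕ → Ω → ℝ := fun j ω => -(coinSign (ξ j ω) * v k / μ) - w0 k with hy
  set S : ℕ → Submodule ℝ (Ω → ℝ) := fun t => Submodule.span ℝ (y '' (Finset.range t : Set ℕ))
    with hS
  have hmono : Monotone S := fun i j hij => Submodule.span_mono
    (Set.image_mono (by exact_mod_cast Finset.range_subset_range.2 hij))
  have hgrad : ∀ j ω, lossGrad (coinLoss μ v) (what j ω) (ξ j ω) k
      = μ * ((what j ω k - w0 k) - y j ω) := by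
    intro j ω
    rw [lossGrad_coinLoss]
    simp only [PiLp.add_apply, PiLp.smul_apply, smul_eq_mul, hy]
    field_simp
    ring
  -- every sum of updates made before iteration `t` lies in the span
  have hsum : ∀ t, (∀ j < t, (fun ω => what j ω k - w0 k) ∈ S j) → ∀ s ⊆ Finset.range t,
      (fun ω => -∑ j ∈ s, η j * lossGrad (coinLoss μ v) (what j ω) (ξ j ω) k) ∈ S t := by
    intro t h s hs
    have e : (fun ω => -∑ j ∈ s, η j * lossGrad (coinLoss μ v) (what j ω) (ξ j ω) k)
        = -∑ j ∈ s, (η j * μ) • ((fun ω => what j ω k - w0 k) - y j) := by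
      funext ω
      simp only [hgrad, Pi.neg_apply, Finset.sum_apply, Pi.smul_apply, Pi.sub_apply, smul_eq_mul,
        mul_assoc]
    rw [e]
    refine (S t).neg_mem ((S t).sum_mem fun j hj => (S t).smul_mem _ ((S t).sub_mem ?_ ?_))
    · have hj' := Finset.mem_range.1 (hs hj)
      exact hmono hj'.le (h j hj')
    · exact Submodule.subset_span (Set.mem_image_of_mem _ (by exact_mod_cast hs hj))
  have hread : ∀ t, (fun ω => what t ω k - w0 k) ∈ S t := by
    intro t
    induction t using Nat.strong_induction_on with
    | _ t ih =>
      obtain ⟨ω0⟩ := nonempty_of_isProbabilityMeasure P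
      have := hsum t ih (V t k) (hr.read_subset_range t k ω0)
      refine (congrArg (· ∈ S t) (funext fun ω => ?_)).mp this
      rw [hr.read_eq]
      change _ = w0 k - ∑ j ∈ V t k, η j * lossGrad (coinLoss μ v) (what j ω) (ξ j ω) k - w0 k
      ring
  have hw : (fun ω => w t ω k - w0 k) ∈ S t := by
    have := hsum t (fun j _ => hread j) _ subset_rfl
    refine (congrArg (· ∈ S t) (funext fun ω => ?_)).mp this
    rw [hr.eq_sub_sum]
    simp
  obtain ⟨β, hβ⟩ := Submodule.mem_span_image_finset_iff_exists_fun' ℝ |>.1 hw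
  refine ⟨β, fun ω => ?_⟩
  have := congrFun hβ ω
  simp only [Finset.sum_apply, Pi.smul_apply, smul_eq_mul] at this
  linarith

/-- The second moment of an affine combination of the starting point, with weight `1 - b`, and of
`t` independent samples of variance `s = N / (2 μ²)`, with weights that sum to `b` and have sum of
squares `q`. It is at least `1 / (1 / R² + t / s)`, hence at least `s / t * (1 - s / (R² t))`; as `log 2 ≤ log t`, the constant `C` turns this into `lowerRate`. -/
lemma lowerRate_le_affine {N R C b t q : ℝ} (hμ : 0 < μ) (hN : 0 < N) (hR : 0 < R) (ht : 2 ≤ t)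
    (hC : C = N / (2 * μ ^ 2) / (R ^ 2 * Real.log 2)) (hq : b ^ 2 ≤ t * q) :
    1 / 2 * (N / μ ^ 2) * (1 / t) * (1 - C * (Real.log t / t))
      ≤ (R * (1 - b)) ^ 2 + N / (2 * μ ^ 2) * q := by
  set s := N / (2 * μ ^ 2) with hs
  have hs0 : 0 < s := by positivity
  have ht0 : 0 < t := by linarith
  have e : 1 / 2 * (N / μ ^ 2) * (1 / t) = s / t := by rw [hs]; field_simp
  have hl2 : 0 < Real.log 2 := Real.log_pos one_lt_two
  have h1 : s / (R ^ 2 * t) ≤ C * (Real.log t / t) := by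
    have : Real.log 2 ≤ Real.log t := Real.log_le_log (by norm_num) ht
    calc s / (R ^ 2 * t) = C * (Real.log 2 / t) := by rw [hC]; field_simp
      _ ≤ _ := by
        have : 0 ≤ C := by rw [hC]; positivity
        gcongr
  have h2 : b ^ 2 / t ≤ q := by rwa [div_le_iff₀ ht0, mul_comm]
  rw [e]
  calc s / t * (1 - C * (Real.log t / t)) ≤ s / t * (1 - s / (R ^ 2 * t)) := by gcongr
    _ ≤ (R * (1 - b)) ^ 2 + s * (b ^ 2 / t) := by
      have h3 : 0 ≤ (R * (1 - b) - s / t / R) ^ 2 + s / t * (1 - b) ^ 2 := by positivity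
      have e2 : (R * (1 - b) - s / t / R) ^ 2 + s / t * (1 - b) ^ 2
          = (R * (1 - b)) ^ 2 + s * (b ^ 2 / t) - s / t * (1 - s / (R ^ 2 * t)) := by
        field_simp
        ring
      linarith
    _ ≤ _ := by gcongr

end Run

/-- The two-point quadratic with noise and starting point on one coordinate axis, where the second
moment of the iterates cannot drop below `1 / (1 / R² + t / s)`, where `s = N / (2 μ²)`. -/
lemma exists_hard_problem {L μ N R : ℝ} (hμ : 0 < μ) (hN : 0 < N) (hR : 0 < R) (hL : μ ≤ L)
    (p : ℕ) (hp : 1 ≤ p) :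
    ∃ (Ξ : Type) (_ : MeasurableSpace Ξ) (D : Measure Ξ)
      (f : EuclideanSpace ℝ (Fin p) → Ξ → ℝ) (wstar w0 : EuclideanSpace ℝ (Fin p)),
      IsProblem D f L μ N wstar ∧ ‖w0 - wstar‖ = R ∧
      ∀ (η : ℕ → ℝ) (τ : ℝ → ℝ) (V : ℕ → Fin p → Finset ℕ)
        (Ω : Type v) (mΩ : MeasurableSpace Ω) (P : Measure Ω) (ℱ : Filtration ℕ mΩ)
        (ξ : ℕ → Ω → Ξ) (w what : ℕ → Ω → EuclideanSpace ℝ (Fin p)),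
        IsRun P D f w0 η τ ℱ ξ (fun t k _ => V t k) w what →
        ∀ t : ℕ, 2 ≤ t → lowerRate μ N (N / (2 * μ ^ 2) / (R ^ 2 * Real.log 2)) t
          ≤ ∫ ω, ‖w t ω - wstar‖ ^ 2 ∂P := by
  set k : Fin p := ⟨0, hp⟩
  set v : EuclideanSpace ℝ (Fin p) := EuclideanSpace.single k (Real.sqrt (N / 2)) with hv
  have hvk : v k ^ 2 = N / 2 := by
    simp only [hv, PiLp.single_apply, if_true]
    exact Real.sq_sqrt (by positivity)
  have hprob : IsProblem coinLaw (coinLoss μ v) L μ N 0 := by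
    refine isProblem_coinLoss μ v hμ hL ?_
    rw [hv, PiLp.norm_single, Real.norm_eq_abs, sq_abs, Real.sq_sqrt (by positivity)]
    ring
  refine ⟨Bool, inferInstance, coinLaw, coinLoss μ v, 0, EuclideanSpace.single k R, hprob, ?_, ?_⟩
  · simp [abs_of_pos hR]
  intro η τ V Ω mΩ P ℱ ξ w what hr t ht
  obtain ⟨β, hβ⟩ := hr.exists_affine_combination hμ k t
  have hP := hr.prob
  have hw0 : (EuclideanSpace.single k R : EuclideanSpace ℝ (Fin p)) k = R := by simp
  have hmem := (hr.memLp hprob (hμ.trans_le hL) t).1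
  have hint := (memLp_two_iff_integrable_sq_norm hmem.1).1 hmem
  set b := ∑ j ∈ Finset.range t, β j with hb
  have e : ∀ ω, w t ω k ^ 2 = (R * (1 - b)
      + ∑ j ∈ Finset.range t, (-(β j * v k / μ)) * coinSign (ξ j ω)) ^ 2 := by
    intro ω
    rw [hβ, hw0, mul_sub, mul_one, hb, Finset.mul_sum, sub_add, ← Finset.sum_sub_distrib,
      sub_eq_add_neg, ← Finset.sum_neg_distrib]
    congr 2
    refine Finset.sum_congr rfl fun j _ => ?_
    ring
  have h1 : ∫ ω, w t ω k ^ 2 ∂P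
      = (R * (1 - b)) ^ 2 + N / (2 * μ ^ 2) * ∑ j ∈ Finset.range t, β j ^ 2 := by
    simp only [e]
    rw [hr.integral_sq_sum_coinSign, Finset.mul_sum]
    congr 1
    refine Finset.sum_congr rfl fun j _ => ?_
    rw [neg_sq, div_pow, mul_pow, hvk]
    field_simp
  have hle : ∀ ω, w t ω k ^ 2 ≤ ‖w t ω - 0‖ ^ 2 := by
    intro ω
    rw [sub_zero, EuclideanSpace.real_norm_sq_eq]
    exact Finset.single_le_sum (f := fun i => w t ω i ^ 2) (fun _ _ => sq_nonneg _)
      (Finset.mem_univ k)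
  have hintk : Integrable (fun ω => w t ω k ^ 2) P := by
    have hm : Measurable (w t) :=
      (hr.measurable_iterates hprob (hμ.trans_le hL) t).1.mono (ℱ.le t) le_rfl
    have hk : Measurable fun x : EuclideanSpace ℝ (Fin p) => x k := by fun_prop
    refine hint.mono' ((hk.comp hm).pow_const 2).aestronglyMeasurable (ae_of_all _ fun ω => ?_)
    rw [Real.norm_of_nonneg (sq_nonneg _)]
    exact hle ω
  refine le_trans ?_ (integral_mono hintk hint hle)
  rw [h1, lowerRate]
  refine lowerRate_le_affine hμ hN hR (by exact_mod_cast ht) rfl ?_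
  simpa using sq_sum_le_card_mul_sum_sq (s := Finset.range t) (f := β)

/-! ### Comparison with the guaranteed rate -/

/-- The offset, of order `√(t / log t)`, dominates every multiple of `log t`. -/
lemma eventually_mul_log_le_offset (d m : ℕ) (L μ C : ℝ) :
    ∀ᶠ t : ℕ in atTop, 2 * (C * Real.log t) ≤ offset d m L μ t - 1 := by
  have hx : Tendsto (fun t : ℕ => M0 m + (t : ℝ)) atTop atTop :=
    (tendsto_M0_add m).comp tendsto_natCast_atTop_atTop
  have h1 := hx.eventually ((Real.isLittleO_pow_log_id_atTop (n := 3)).bound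
    (show (0 : ℝ) < 1 / (4 * C ^ 2 + 1) by positivity))
  filter_upwards [h1, hx.eventually_gt_atTop 1, eventually_gt_atTop 0] with t ht hx1 ht0
  have hlog := Real.log_pos hx1
  have hM := one_le_M1 d m L μ
  have hM0 : 0 ≤ M0 m := by unfold M0; positivity
  have ht0' : (0 : ℝ) < t := by exact_mod_cast ht0
  rw [Real.norm_of_nonneg (by positivity), id, Real.norm_of_nonneg (by linarith)] at ht
  have hle : Real.log t ≤ Real.log (M0 m + t) := Real.log_le_log ht0' (by linarith)
  set x := M0 m + (t : ℝ) with hxdef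
  have h2 : 2 * |C| * Real.log x ≤ Real.sqrt (x / Real.log x) := by
    apply Real.le_sqrt_of_sq_le
    rw [le_div_iff₀ hlog]
    have e : (2 * |C| * Real.log x) ^ 2 * Real.log x = 4 * C ^ 2 * Real.log x ^ 3 := by
      rw [mul_pow, mul_pow, sq_abs]; ring
    rw [e]
    rw [one_div, ← div_eq_inv_mul, le_div_iff₀ (by positivity)] at ht
    have : 0 ≤ Real.log x ^ 3 := by positivity
    linarith
  have h3 : C * Real.log t ≤ |C| * Real.log x := by
    have h0 : 0 ≤ Real.log (t : ℝ) := Real.log_nonneg (by exact_mod_cast ht0)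
    calc C * Real.log t ≤ |C| * Real.log t := mul_le_mul_of_nonneg_right (le_abs_self C) h0
      _ ≤ _ := by gcongr
  unfold offset
  linarith

lemma eventually_le_rate (d m : ℕ) (L : ℝ) {μ N : ℝ} (hμ : 0 < μ) (hN : 0 < N) :
    ∀ᶠ t : ℕ in atTop, 1000 * N / μ ^ 2 / t ≤ rate d m L μ N t := by
  have hlt : 1000 * N / μ ^ 2 < 8 * 36 ^ 2 * N / μ ^ 2 := by
    gcongr
    norm_num
  filter_upwards [(tendsto_mul_rate d m L μ N).eventually_const_le hlt,
    eventually_gt_atTop 0] with t ht ht0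
  have ht' : (0 : ℝ) < t := by exact_mod_cast ht0
  rw [div_le_iff₀ ht']
  linarith

/-- The iterates and the read vectors of all runs eventually stay below the guaranteed rate, from
a time on that depends on the parameters only. -/
theorem exists_forall_run_le_rate {d m : ℕ} (hm : 2 * Real.exp 1 * ((d : ℝ) + 1) ≤ (m : ℝ) + 1)
    {L μ N R : ℝ} (hL : 0 < L) (hμ : 0 < μ) (hN : 0 < N) :
    ∃ T0 : ℕ, ∀ (p : ℕ) (Ξ : Type u) [MeasurableSpace Ξ] (D : Measure Ξ)
      (f : EuclideanSpace ℝ (Fin p) → Ξ → ℝ) (wstar w0 : EuclideanSpace ℝ (Fin p)),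
      IsProblem D f L μ N wstar → ‖w0 - wstar‖ ≤ R →
      ∀ (Ω : Type v) (mΩ : MeasurableSpace Ω) (P : Measure Ω) (ℱ : Filtration ℕ mΩ)
        (ξ : ℕ → Ω → Ξ) (U : ℕ → Fin p → Ω → Finset ℕ)
        (w what : ℕ → Ω → EuclideanSpace ℝ (Fin p)),
        IsRun P D f w0 (stepSize d m L μ) (delay d m L μ) ℱ ξ U w what →
        ∀ t : ℕ, T0 ≤ t →
          (Integrable (fun ω => ‖w t ω - wstar‖ ^ 2) P ∧
            ∫ ω, ‖w t ω - wstar‖ ^ 2 ∂P ≤ rate d m L μ N t) ∧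
          (Integrable (fun ω => ‖what t ω - wstar‖ ^ 2) P ∧
            ∫ ω, ‖what t ω - wstar‖ ^ 2 ∂P ≤ rate d m L μ N t) := by
  have hrec := DelayedRecursion.eventually_le (R := R) (stepSize_pos (d := d) (m := m) (L := L) hμ)
    hL hμ hN (eventually_stepSize_le hm hμ) (eventually_le_stepSize hm hμ)
    (tendsto_window_sq_div d m L μ)
  obtain ⟨T0, hT0⟩ := eventually_atTop.1 (hrec.and (eventually_le_rate d m L hμ hN))
  refine ⟨T0, fun p Ξ _ D f wstar w0 hf hR Ω mΩ P ℱ ξ U w what hr t ht => ?_⟩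
  have hd := hr.delayedRecursion hf hL hμ (stepSize_pos hμ) hR
  have hle := ((hT0 t ht).1 _ _ _ hd).trans (hT0 t ht).2
  have ha := hd.a_nonneg t
  have hb := hd.b_nonneg t
  obtain ⟨m1, m2, -⟩ := hr.memLp hf hL t
  have m4 := hr.memLp_read hf hL t
  have i1 := (memLp_two_iff_integrable_sq_norm m1.1).1 m1
  have i2 := (memLp_two_iff_integrable_sq_norm m2.1).1 m2
  have i4 := (memLp_two_iff_integrable_sq_norm m4.1).1 m4
  have hread : ∫ ω, ‖what t ω - wstar‖ ^ 2 ∂P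
      ≤ 2 * ∫ ω, ‖w t ω - wstar‖ ^ 2 ∂P + 2 * ∫ ω, ‖w t ω - what t ω‖ ^ 2 ∂P := by
    rw [← integral_const_mul, ← integral_const_mul,
      ← integral_add (i1.const_mul _) (i2.const_mul _)]
    refine integral_mono i4 ((i1.const_mul _).add (i2.const_mul _)) fun ω => ?_
    have h := norm_sq_le_two_mul (what t ω - wstar) (w t ω - wstar)
    rw [sub_sub_sub_cancel_right, norm_sub_rev (what t ω) (w t ω)] at h
    exact h
  exact ⟨⟨i1, by linarith⟩, i4, by linarith⟩

end

end AsyncFL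

theorem mainTheorem2 (d m : ℕ) (hm : 2 * Real.exp 1 * ((d : ℝ) + 1) ≤ (m : ℝ) + 1)
    (L μ N R : ℝ) (hL : 0 < L) (hμ : 0 < μ) (hN : 0 < N) (hR : 0 < R) :
    -- the sample sizes
    (Monotone (AsyncFL.sampleSize d m) ∧
      ((fun i : ℕ => (AsyncFL.sampleSize d m i : ℝ)) =Θ[atTop]
        fun i : ℕ => (i : ℝ) / Real.log i) ∧
      AsyncFL.DelayCondition (AsyncFL.delay d m L μ) (AsyncFL.sampleSize d m) d) ∧
    -- the round step sizes
    (Antitone (AsyncFL.roundStep d m L μ) ∧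
      (AsyncFL.roundStep d m L μ =O[atTop] fun i : ℕ => Real.log i / (i : ℝ) ^ 2)) ∧
    -- the convergence rate
    (∃ T0 : ℕ, ∀ (p : ℕ) (Ξ : Type u) [MeasurableSpace Ξ] (D : Measure Ξ)
      (f : EuclideanSpace ℝ (Fin p) → Ξ → ℝ) (wstar w0 : EuclideanSpace ℝ (Fin p)),
      AsyncFL.IsProblem D f L μ N wstar → ‖w0 - wstar‖ ≤ R →
      ∀ (Ω : Type v) (mΩ : MeasurableSpace Ω) (P : Measure Ω) (ℱ : Filtration ℕ mΩ)
        (ξ : ℕ → Ω → Ξ) (U : ℕ → Fin p → Ω → Finset ℕ)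
        (w what : ℕ → Ω → EuclideanSpace ℝ (Fin p)),
        AsyncFL.IsRun P D f w0 (AsyncFL.stepSize d m L μ) (AsyncFL.delay d m L μ) ℱ ξ U w what →
        ∀ t : ℕ, T0 ≤ t →
          (Integrable (fun ω => ‖w t ω - wstar‖ ^ 2) P ∧
            ∫ ω, ‖w t ω - wstar‖ ^ 2 ∂P ≤ AsyncFL.rate d m L μ N t) ∧
          (Integrable (fun ω => ‖what t ω - wstar‖ ^ 2) P ∧
            ∫ ω, ‖what t ω - wstar‖ ^ 2 ∂P ≤ AsyncFL.rate d m L μ N t)) ∧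
    -- the asymptotic form of the rate
    (Tendsto (fun t : ℕ => (t : ℝ) * AsyncFL.rate d m L μ N t) atTop
        (𝓝 (8 * 36 ^ 2 * N / μ ^ 2)) ∧
      ∀ c : ℝ, ∀ᶠ t : ℕ in atTop, AsyncFL.rate d m L μ N t ≤
        8 * 36 ^ 2 * N / μ ^ 2 * (1 / (t : ℝ)) * (1 - c * (1 / (t : ℝ)))) ∧
    -- optimality up to the factor 16 * 36 ^ 2
    (μ ≤ L → ∃ C : ℝ,
      (∀ᶠ t : ℕ in atTop,
        AsyncFL.rate d m L μ N t ≤ 16 * 36 ^ 2 * AsyncFL.lowerRate μ N C t) ∧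
      ∀ p : ℕ, 1 ≤ p → ∃ (Ξ : Type) (_ : MeasurableSpace Ξ) (D : Measure Ξ)
        (f : EuclideanSpace ℝ (Fin p) → Ξ → ℝ) (wstar w0 : EuclideanSpace ℝ (Fin p)),
        AsyncFL.IsProblem D f L μ N wstar ∧ ‖w0 - wstar‖ = R ∧
        ∀ (η : ℕ → ℝ) (τ : ℝ → ℝ) (V : ℕ → Fin p → Finset ℕ)
          (Ω : Type v) (mΩ : MeasurableSpace Ω) (P : Measure Ω) (ℱ : Filtration ℕ mΩ)
          (ξ : ℕ → Ω → Ξ) (w what : ℕ → Ω → EuclideanSpace ℝ (Fin p)),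
          AsyncFL.IsRun P D f w0 η τ ℱ ξ (fun t k _ => V t k) w what →
          ∀ t : ℕ, 2 ≤ t →
            AsyncFL.lowerRate μ N C t ≤ ∫ ω, ‖w t ω - wstar‖ ^ 2 ∂P) := by
  refine ⟨⟨AsyncFL.sampleSize_mono hm, AsyncFL.sampleSize_isTheta d m,
      AsyncFL.delayCondition hm L μ⟩,
    ⟨AsyncFL.roundStep_antitone hm hμ, AsyncFL.roundStep_isBigO hm hμ⟩,
    AsyncFL.exists_forall_run_le_rate hm hL hμ hN,
    ⟨AsyncFL.tendsto_mul_rate d m L μ N, fun c => ?_⟩, fun hμL =>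
    ⟨N / (2 * μ ^ 2) / (R ^ 2 * Real.log 2), ?_,
      fun p hp => AsyncFL.exists_hard_problem hμ hN hR hμL p hp⟩⟩
  · have hoff := (AsyncFL.tendsto_offset d m L μ).comp (tendsto_natCast_atTop_atTop (R := ℝ))
    have hg : ∀ᶠ t : ℕ in atTop, 2 * c ≤ AsyncFL.offset d m L μ t - 1 := by
      filter_upwards [hoff.eventually_ge_atTop (2 * c + 1)] with t ht
      simp only [Function.comp_apply] at ht
      linarith
    filter_upwards [AsyncFL.eventually_rate_le d m L hN hμ hg] with t ht
    rwa [mul_one_div c]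
  · filter_upwards [AsyncFL.eventually_rate_le d m L hN hμ
      (AsyncFL.eventually_mul_log_le_offset d m L μ
        (N / (2 * μ ^ 2) / (R ^ 2 * Real.log 2)))] with t ht
    refine ht.trans (le_of_eq ?_)
    rw [AsyncFL.lowerRate, mul_div_assoc (N / (2 * μ ^ 2) / (R ^ 2 * Real.log 2))]
    ring
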